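/- Let $(\varepsilon_i)_{i\ge 1}$ be i.i.d. real random variables with mean zero and variance $\sigma^2<\infty$. For each sample size $n$ let $p=p_n\in\mathbb N$ with $p_n\to\infty$, let $k=k_n\in\mathbb N$ with $\theta=\theta_{nk}=k/n\to\theta^0\in(0,1)$, let $X_1,\dots,X_n\in\mathbb R^{p}$ be deterministic (they may depend on $n$), and let $Y_i=X_i^t\beta^0+\varepsilon_i$ for $1\le i\le k$ and $Y_i=X_i^t\beta_2^0+\varepsilon_i$ for $k<i\le n$. Put $z_i(\beta)=X_i(Y_i-X_i^t\beta)$, $z_i^0=X_i\varepsilon_i$, $$V_n^0=\frac1{n\theta^2}\sum_{i=1}^k \mathrm{Var}(z_i^0)+\frac1{n(1-\theta)^2}\sum_{j=k+1}^n \mathrm{Var}(z_j^0),\qquad \mathrm{Var}(z_i^0)=\sigma^2X_iX_i^t,$$ $$\psi_n^0=\frac1{n\theta}\sum_{i=1}^k z_i(\beta^0)-\frac1{n(1-\theta)}\sum_{j=k+1}^n z_j(\beta^0),$$ $w_i^0=(V_n^0)^{-1/2}z_i(\beta^0)=(w^0_{i,1},\dots,w^0_{i,p})$ and $$\alpha^{t_1\cdots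 t_m}=\frac1{n\theta^m}\sum_{i=1}^k E[w^0_{i,t_1}\cdots w^0_{i,t_m}]+\frac1{n(\theta-1)^m}\sum_{j=k+1}^n E[w^0_{j,t_1}\cdots w^0_{j,t_m}].$$ The empirical likelihood ratio statistic is $$EL_{nk}(\beta)=2\sum_{i=1}^k\log\Big(1+\frac nk\lambda^tz_i(\beta)\Big)+2\sum_{j=k+1}^n\log\Big(1-\frac n{n-k}\lambda^tz_j(\beta)\Big),$$ where the Lagrange multiplier $\lambda\in\mathbb R^p$ satisfies $$\sum_{i=1}^k\frac{z_i(\beta)}{k/n+\lambda^tz_i(\beta)}-\sum_{j=k+1}^n\frac{z_j(\beta)}{1-k/n-\lambda^tz_j(\beta)}=0,$$ all denominators being positive (if there is no such $\lambda$, the statistic is given an arbitrary value). Assume that, for some constants $C_0,C_1,C_3>0$ and some real $q\ge4$: (A1) for all large $n$ every eigenvalue of $V_n^0$ lies in $(C_0,C_1)$; (A3) $p^{-1}\sum_{s=1}^p|X_{i,s}|^q<C_3$ for all $n$ and $1\le i\le n$; (A4) $E|\varepsilon_1|^{2q}<\infty$; (A6) $p^{2+4/q}k^{-1}\to0$ and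 $p^{2+4/q}(n-k)^{-1}\to0$ as $n\to\infty$; (A7) $\sum_{r,s=1}^p\alpha^{rrss}=O(p^2)$. If the null hypothesis $H_0:\ \beta_2^0=\beta^0$ (for every $n$) is true, then, with probability tending to one as $n\to\infty$, the multiplier $\lambda$ at $\beta=\beta^0$ exists, and $$EL_{nk}(\beta^0)=n\,\psi_n^{0t}(V_n^0)^{-1}\psi_n^0+o_P(p^{1/2}).$$ -/

import Mathlib

open MeasureTheory ProbabilityTheory Filter Topology
open scoped Matrix

noncomputable section

/-- The data of a (triangular array of) two-phase linear model(s) with deterministic design.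
For the sample size `n` there are `p n` explanatory variables and the change occurs after
the first `k n` observations. Observations are numbered from `0`: the first phase consists of the
indices `i < k n`, the second phase of the indices `k n ≤ i < n`.
`X n i` is the vector of explanatory variables of observation `i`, `β n` and `β₂ n` are the
(true) regression parameters of the two phases, and `ε i` is the error of observation `i`. -/
structure TwoPhaseModel (Ω : Type*) where
  p : ℕ → ℕ
  k : ℕ → ℕ
  X : (n : ℕ) → ℕ → Fin (p n) → ℝ
  β : (n : ℕ) → Fin (p n) → ℝ
  β₂ : (n : ℕ) → Fin (p n) → ℝ
  ε : ℕ → Ω → ℝ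

namespace TwoPhaseModel

variable {Ω : Type*} (M : TwoPhaseModel Ω)

/-- The null hypothesis of no change. -/
def NoChange : Prop := ∀ n, M.β₂ n = M.β n

/-- The response variable. -/
def Y (n i : ℕ) (ω : Ω) : ℝ :=
  if i < M.k n then M.X n i ⬝ᵥ M.β n + M.ε i ω else M.X n i ⬝ᵥ M.β₂ n + M.ε i ω

/-- The relative location of the change-point. -/
def θ (n : ℕ) : ℝ := (M.k n : ℝ) / n

/-- `z_i(b) = X_i (Y_i - X_iᵗ b)`. -/
def z (n i : ℕ) (b : Fin (M.p n) → ℝ) (ω : Ω) : Fin (M.p n) → ℝ :=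
  (M.Y n i ω - M.X n i ⬝ᵥ b) • M.X n i

/-- `z_i⁰ = X_i ε_i`. -/
def z₀ (n i : ℕ) (ω : Ω) : Fin (M.p n) → ℝ := M.ε i ω • M.X n i

/-- `l` is a Lagrange multiplier at the parameter `b`: it solves the estimating equation, and the
weights `1 / (k + n lᵗ z_i)` and `1 / (n - k - n lᵗ z_j)` that it induces on the observations of
the two phases are positive (so that the logarithms in the statistic are meaningful). -/
structure IsLagrangeMultiplier (n : ℕ) (b : Fin (M.p n) → ℝ) (ω : Ω)
    (l : Fin (M.p n) → ℝ) : Prop where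
  pos_left : ∀ i ∈ Finset.range (M.k n), 0 < M.θ n + l ⬝ᵥ M.z n i b ω
  pos_right : ∀ j ∈ Finset.Ico (M.k n) n, 0 < 1 - M.θ n - l ⬝ᵥ M.z n j b ω
  equation :
    ∑ i ∈ Finset.range (M.k n), (1 / (M.θ n + l ⬝ᵥ M.z n i b ω)) • M.z n i b ω
      - ∑ j ∈ Finset.Ico (M.k n) n, (1 / (1 - M.θ n - l ⬝ᵥ M.z n j b ω)) • M.z n j b ω = 0

/-- The empirical likelihood ratio statistic at the parameter `b`, as a function of the
Lagrange multiplier `l`. -/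
def EL (n : ℕ) (b : Fin (M.p n) → ℝ) (ω : Ω) (l : Fin (M.p n) → ℝ) : ℝ :=
  2 * ∑ i ∈ Finset.range (M.k n),
      Real.log (1 + (n : ℝ) / (M.k n : ℝ) * (l ⬝ᵥ M.z n i b ω))
    + 2 * ∑ j ∈ Finset.Ico (M.k n) n,
      Real.log (1 - (n : ℝ) / ((n : ℝ) - (M.k n : ℝ)) * (l ⬝ᵥ M.z n j b ω))

/-- The difference `ψ_n(b)` of the phase means of the `z_i(b)`. -/
def ψ (n : ℕ) (b : Fin (M.p n) → ℝ) (ω : Ω) : Fin (M.p n) → ℝ :=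
  (1 / ((n : ℝ) * M.θ n)) • ∑ i ∈ Finset.range (M.k n), M.z n i b ω
    - (1 / ((n : ℝ) * (1 - M.θ n))) • ∑ j ∈ Finset.Ico (M.k n) n, M.z n j b ω

variable [MeasurableSpace Ω] (μ : Measure Ω)

/-- The covariance matrix of `z_i⁰`. -/
def Vi (n i : ℕ) : Matrix (Fin (M.p n)) (Fin (M.p n)) ℝ :=
  Matrix.of fun r s => covariance (fun ω => M.z₀ n i ω r) (fun ω => M.z₀ n i ω s) μ

/-- The matrix `V_n⁰`. -/
def V (n : ℕ) : Matrix (Fin (M.p n)) (Fin (M.p n)) ℝ :=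
  (1 / ((n : ℝ) * M.θ n ^ 2)) • ∑ i ∈ Finset.range (M.k n), M.Vi μ n i
    + (1 / ((n : ℝ) * (1 - M.θ n) ^ 2)) • ∑ j ∈ Finset.Ico (M.k n) n, M.Vi μ n j

/-- The standardized vectors `w_i⁰ = (V_n⁰)^{-1/2} z_i(β)`; the power `-1/2` of the symmetric
matrix `V_n⁰` is taken in the functional calculus. -/
def w (n i : ℕ) (ω : Ω) : Fin (M.p n) → ℝ :=
  cfc (fun x : ℝ => x ^ (-(1 / 2) : ℝ)) (M.V μ n) *ᵥ M.z n i (M.β n) ω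

/-- The averaged mixed moments `α^{t_1 ⋯ t_m}` of the standardized vectors. -/
def α (n : ℕ) {m : ℕ} (t : Fin m → Fin (M.p n)) : ℝ :=
  1 / ((n : ℝ) * M.θ n ^ m) *
      ∑ i ∈ Finset.range (M.k n), ∫ ω, ∏ l, M.w μ n i ω (t l) ∂μ
    + 1 / ((n : ℝ) * (M.θ n - 1) ^ m) *
      ∑ j ∈ Finset.Ico (M.k n) n, ∫ ω, ∏ l, M.w μ n j ω (t l) ∂μ

end TwoPhaseModel

/-- `R_n = o_P(a_n)` for a positive sequence `a`. -/
def IsLittleOP {Ω : Type*} [MeasurableSpace Ω] (μ : Measure Ω) (R : ℕ → Ω → ℝ) (a : ℕ → ℝ) :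
    Prop :=
  ∀ δ : ℝ, 0 < δ → Tendsto (fun n => μ {ω | δ * a n < |R n ω|}) atTop (𝓝 0)

end

/-! Under the null hypothesis the two-phase statistic is a one-sample empirical likelihood. Dividing
$X_i$ by $\theta$ in the first phase and by $-(1-\theta)$ in the second gives fixed vectors $x_i$.
With $u_i=\varepsilon_i x_i$, $\psi_n^0$ is the mean $\bar u$ of the $u_i$, $V=V_n^0=\sigma^2
n^{-1}\sum x_ix_i^t$, and the statistic is $2\sum\log(1+\lambda^tu_i)$ (`isLagrangeMultiplier_iff`,
`EL_eq`, `ψ_eq`, `V_eq`).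

The multiplier itself is never expanded; the statistic is squeezed between two explicit bounds. Let
$S=n^{-1}\sum u_iu_i^t$, $l_0=V^{-1}\bar u$ and $b=S^{-1}\bar u$. By concavity $\lambda$ maximizes
$\sum\log(1+l^tu_i)$, so the trial value $l_0$ gives a lower bound (`IsELMultiplier.sum_log_le`).
The weights $1-u_i^tb$ are positive and balance the $u_i$, so weak duality gives an upper bound
(`sum_log_le_of_balanced`); the same weights yield existence (`exists_isELMultiplier`). To second
order both bounds equal half of $n\,\bar u^tV^{-1}\bar u$. The errors are controlled by the residual
$\rho=(S-V)l_0$ and by cubic sums, which Cauchy–Schwarz reduces to $\sum(u_i^tl_0)^4$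
(`exists_multiplier_and_abs_sub_le`).

Four expectations then suffice, with $|x_i|^2=O(p)$: $nE|l_0|^2=O(p)$,
$E\sum(u_i^tl_0)^4=O(p^2/n+p^4/n^3)$, $E\|S-V\|_F^2=O(p^2/n)$ and $nE|\rho|^2=O(p^2/n)$. The last is
the decisive one (`integral_residual_sq_le`): $\rho$ is estimated directly rather than through
$\|S-V\|\,|l_0|$, which would lose a factor $p$. With $e^8=p^2/n\to0$, Markov's inequality makes the
expansion error $O(\sqrt p\,e)$ outside an event of probability $O(e^2)$
(`measure_not_expansion_le`). -/

/-! ### Empirical likelihood: deterministic part -/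

/-- The average over `I` (with normalization `N`) of the outer products `u i (u i)ᵗ`. -/
noncomputable def meanOuter {κ ι : Type*} (I : Finset κ) (N : ℝ) (u : κ → ι → ℝ) : Matrix ι ι ℝ :=
  N⁻¹ • ∑ i ∈ I, Matrix.vecMulVec (u i) (u i)

/-- `l` is a Lagrange multiplier of the empirical likelihood for the mean of the vectors `u i`. -/
structure IsELMultiplier {κ ι : Type*} [Fintype ι] (I : Finset κ) (u : κ → ι → ℝ) (l : ι → ℝ) :
    Prop where
  pos : ∀ i ∈ I, 0 < 1 + l ⬝ᵥ u i
  equation : ∑ i ∈ I, (1 / (1 + l ⬝ᵥ u i)) • u i = 0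

section Deterministic

variable {κ ι : Type*} [Fintype ι] {I : Finset κ} {u : κ → ι → ℝ}

lemma meanOuter_mulVec (I : Finset κ) (N : ℝ) (u : κ → ι → ℝ) (v : ι → ℝ) :
    meanOuter I N u *ᵥ v = N⁻¹ • ∑ i ∈ I, (u i ⬝ᵥ v) • u i := by
  rw [meanOuter, Matrix.smul_mulVec, Matrix.sum_mulVec]
  simp [Matrix.vecMulVec_mulVec]

lemma dotProduct_meanOuter_mulVec (I : Finset κ) (N : ℝ) (u : κ → ι → ℝ) (w v : ι → ℝ) :
    w ⬝ᵥ (meanOuter I N u *ᵥ v) = N⁻¹ * ∑ i ∈ I, (u i ⬝ᵥ w) * (u i ⬝ᵥ v) := by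
  rw [meanOuter_mulVec, dotProduct_smul, dotProduct_sum, smul_eq_mul]
  congr 1
  refine Finset.sum_congr rfl fun i _ => ?_
  rw [dotProduct_smul, smul_eq_mul, dotProduct_comm w, mul_comm]

lemma dotProduct_meanOuter_mulVec_comm (I : Finset κ) (N : ℝ) (u : κ → ι → ℝ) (w v : ι → ℝ) :
    w ⬝ᵥ (meanOuter I N u *ᵥ v) = v ⬝ᵥ (meanOuter I N u *ᵥ w) := by
  simp only [dotProduct_meanOuter_mulVec, mul_comm (_ ⬝ᵥ w)]

lemma sq_dotProduct_le (v w : ι → ℝ) : (v ⬝ᵥ w) ^ 2 ≤ (v ⬝ᵥ v) * (w ⬝ᵥ w) := by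
  have := Finset.sum_mul_sq_le_sq_mul_sq Finset.univ v w
  simpa only [dotProduct, sq] using this

lemma dotProduct_self_nonneg' (v : ι → ℝ) : 0 ≤ v ⬝ᵥ v :=
  Finset.sum_nonneg fun i _ => mul_self_nonneg (v i)

lemma abs_log_one_add_sub_le {x : ℝ} (hx : |x| ≤ 1 / 2) :
    |Real.log (1 + x) - (x - x ^ 2 / 2)| ≤ 2 * |x| ^ 3 := by
  have h := Real.abs_log_sub_add_sum_range_le (x := -x) (by rw [abs_neg]; linarith) 2
  rw [abs_neg] at h
  have e : (∑ i ∈ Finset.range 2, (-x) ^ (i + 1) / ((i : ℝ) + 1)) + Real.log (1 - -x)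
      = Real.log (1 + x) - (x - x ^ 2 / 2) := by
    rw [Finset.sum_range_succ, Finset.sum_range_succ, Finset.sum_range_zero]
    norm_num
    ring
  rw [e] at h
  refine h.trans ?_
  rw [div_le_iff₀ (by linarith)]
  have h3 : 0 ≤ |x| ^ 3 := pow_nonneg (abs_nonneg x) 3
  calc |x| ^ (2 + 1) = 2 * |x| ^ 3 * (1 / 2) := by ring
    _ ≤ 2 * |x| ^ 3 * (1 - |x|) := mul_le_mul_of_nonneg_left (by linarith) (by positivity)

/-- If positive weights balance the vectors `u i`, which span the space, then the empirical
likelihood has a Lagrange multiplier. -/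
lemma exists_isELMultiplier {v : κ → ℝ} (hv : ∀ i ∈ I, 0 < v i) (hvu : ∑ i ∈ I, v i • u i = 0)
    (hinj : ∀ l : ι → ℝ, (∀ i ∈ I, l ⬝ᵥ u i = 0) → l = 0) : ∃ l, IsELMultiplier I u l := by
  classical
  have hcont : ∀ i, Continuous fun l : ι → ℝ => 1 + l ⬝ᵥ u i := fun i => by
    unfold dotProduct
    fun_prop
  set K : Set (ι → ℝ) := {l | ∀ i ∈ I, 0 ≤ 1 + l ⬝ᵥ u i} with hK
  have hKclosed : IsClosed K := by
    have : K = ⋂ i ∈ I, {l | 0 ≤ 1 + l ⬝ᵥ u i} := by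
      ext l
      simp [hK]
    rw [this]
    exact isClosed_biInter fun i _ => isClosed_le continuous_const (hcont i)
  let L : (ι → ℝ) →ₗ[ℝ] (I → ℝ) :=
    { toFun := fun l i => l ⬝ᵥ u i
      map_add' := fun a b => by ext i; simp [add_dotProduct]
      map_smul' := fun a b => by ext i; simp [smul_dotProduct] }
  have hLker : LinearMap.ker L = ⊥ := by
    rw [LinearMap.ker_eq_bot']
    intro l hl
    exact hinj l fun i hi => congrFun hl ⟨i, hi⟩
  obtain ⟨c, -, hc⟩ := L.exists_antilipschitzWith hLker
  have hKbdd : Bornology.IsBounded K := by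
    set W := ∑ i ∈ I, v i with hW
    -- On `K` the terms `v i * (1 + l ⬝ᵥ u i)` are nonnegative and sum to the fixed number `W`, so
    -- each `l ⬝ᵥ u i` is bounded on both sides. Injectivity of `L` turns this into boundedness of
    -- `l`.
    have hsub : K ⊆ L ⁻¹' (Set.pi Set.univ fun i : I => Set.Icc (-1) (W / v i)) := by
      intro l hl i _
      have hi := i.2
      have h0 : ∑ i ∈ I, v i * (l ⬝ᵥ u i) = 0 := by
        have := congrArg (fun y => l ⬝ᵥ y) hvu
        simpa [dotProduct_sum, dotProduct_smul] using this
      have h1 : ∑ i ∈ I, v i * (1 + l ⬝ᵥ u i) = W := by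
        simp only [mul_add, Finset.sum_add_distrib, h0, mul_one, add_zero, hW]
      have h2 : v i * (1 + l ⬝ᵥ u i) ≤ W := by
        rw [← h1]
        exact Finset.single_le_sum (f := fun i => v i * (1 + l ⬝ᵥ u i))
          (fun j hj => mul_nonneg (hv j hj).le (hl j hj)) hi
      refine ⟨by have := hl i hi; change -1 ≤ l ⬝ᵥ u i; linarith, ?_⟩
      change l ⬝ᵥ u i ≤ _
      rw [le_div_iff₀ (hv i hi)]
      nlinarith [hv i hi]
    exact (hc.isBounded_preimage
      (Bornology.IsBounded.pi fun i => Metric.isBounded_Icc _ _)).subset hsub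
  have hKcpt : IsCompact K := Metric.isCompact_of_isClosed_isBounded hKclosed hKbdd
  have h0K : (0 : ι → ℝ) ∈ K := fun i _ => by simp
  -- The product is maximized instead of the sum of logarithms: it is continuous on all of `K`, and
  -- it vanishes where a constraint is active. Its value 1 at the origin therefore forces the
  -- maximizer into the open region, where the logarithms can be differentiated.
  obtain ⟨l, hlK, hlmax⟩ := hKcpt.exists_isMaxOn ⟨0, h0K⟩
    (f := fun l => ∏ i ∈ I, (1 + l ⬝ᵥ u i))
    (continuous_finsetProd _ fun i _ => hcont i).continuousOn
  have hprod : 1 ≤ ∏ i ∈ I, (1 + l ⬝ᵥ u i) := by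
    have := hlmax h0K
    simpa using this
  have hpos : ∀ i ∈ I, 0 < 1 + l ⬝ᵥ u i := by
    intro i hi
    refine lt_of_le_of_ne (hlK i hi) fun h => ?_
    rw [Finset.prod_eq_zero hi h.symm] at hprod
    linarith
  refine ⟨l, hpos, ?_⟩
  set r := ∑ i ∈ I, (1 / (1 + l ⬝ᵥ u i)) • u i with hr
  suffices h : ∀ d : ι → ℝ, d ⬝ᵥ r = 0 from dotProduct_self_eq_zero.mp (h r)
  intro d
  have hderiv : HasDerivAt (fun t : ℝ => ∑ i ∈ I, Real.log (1 + (l + t • d) ⬝ᵥ u i))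
      (∑ i ∈ I, (d ⬝ᵥ u i) / (1 + (l + (0 : ℝ) • d) ⬝ᵥ u i)) 0 := by
    refine HasDerivAt.fun_sum fun i hi => HasDerivAt.log ?_ (by simpa using (hpos i hi).ne')
    have : (fun t : ℝ => 1 + (l + t • d) ⬝ᵥ u i) = fun t => (1 + l ⬝ᵥ u i) + t * (d ⬝ᵥ u i) := by
      ext t
      rw [add_dotProduct, smul_dotProduct, smul_eq_mul, add_assoc]
    rw [this]
    simpa using ((hasDerivAt_id (0 : ℝ)).mul_const (d ⬝ᵥ u i)).const_add (1 + l ⬝ᵥ u i)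
  have hmax : IsLocalMax (fun t : ℝ => ∑ i ∈ I, Real.log (1 + (l + t • d) ⬝ᵥ u i)) 0 := by
    have hev : ∀ᶠ t in 𝓝 (0 : ℝ), ∀ i ∈ I, 0 < 1 + (l + t • d) ⬝ᵥ u i := by
      rw [Filter.eventually_all_finset]
      intro i hi
      have hc' : ContinuousAt (fun t : ℝ => 1 + (l + t • d) ⬝ᵥ u i) 0 :=
        ((hcont i).comp (by fun_prop : Continuous fun t : ℝ => l + t • d)).continuousAt
      exact hc'.eventually_const_lt (by simpa using hpos i hi)
    filter_upwards [hev] with t ht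
    simp only [zero_smul, add_zero]
    rw [← Real.log_prod fun i hi => (ht i hi).ne', ← Real.log_prod fun i hi => (hpos i hi).ne']
    exact Real.log_le_log (Finset.prod_pos ht) (hlmax fun i hi => (ht i hi).le)
  have h := hmax.hasDerivAt_eq_zero hderiv
  rw [hr, dotProduct_sum, ← h]
  refine Finset.sum_congr rfl fun i _ => ?_
  rw [dotProduct_smul, smul_eq_mul, zero_smul, add_zero]
  ring

/-- A Lagrange multiplier maximizes the dual of the empirical likelihood. -/
lemma IsELMultiplier.sum_log_le {l : ι → ℝ} (h : IsELMultiplier I u l) {l' : ι → ℝ}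
    (hl' : ∀ i ∈ I, 0 < 1 + l' ⬝ᵥ u i) :
    ∑ i ∈ I, Real.log (1 + l' ⬝ᵥ u i) ≤ ∑ i ∈ I, Real.log (1 + l ⬝ᵥ u i) := by
  have h0 : ∑ i ∈ I, ((l' - l) ⬝ᵥ u i) / (1 + l ⬝ᵥ u i) = 0 := by
    have := congrArg (fun y => (l' - l) ⬝ᵥ y) h.equation
    rw [dotProduct_sum, dotProduct_zero] at this
    rw [← this]
    refine Finset.sum_congr rfl fun i _ => ?_
    rw [dotProduct_smul, smul_eq_mul]
    ring
  rw [← sub_nonpos, ← Finset.sum_sub_distrib, ← h0]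
  refine Finset.sum_le_sum fun i hi => ?_
  have hp := h.pos i hi
  rw [← Real.log_div (hl' i hi).ne' hp.ne']
  -- Tangent-line inequality for the ratio of the two factors; ratio minus one is exactly the
  -- summand that the estimating equation makes vanish in total.
  refine (Real.log_le_sub_one_of_pos (div_pos (hl' i hi) hp)).trans (le_of_eq ?_)
  rw [sub_dotProduct]
  field_simp
  ring

/-- Weak duality for the empirical likelihood. -/
lemma sum_log_le_of_balanced {l : ι → ℝ} (hl : ∀ i ∈ I, 0 < 1 + l ⬝ᵥ u i) {v : κ → ℝ}
    (hv : ∀ i ∈ I, 0 < v i) (hvu : ∑ i ∈ I, v i • u i = 0) :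
    ∑ i ∈ I, Real.log (1 + l ⬝ᵥ u i) ≤ ∑ i ∈ I, (v i - 1 - Real.log (v i)) := by
  have h0 : ∑ i ∈ I, v i * (l ⬝ᵥ u i) = 0 := by
    have := congrArg (fun y => l ⬝ᵥ y) hvu
    simpa [dotProduct_sum, dotProduct_smul] using this
  rw [← add_zero (∑ i ∈ I, (v i - 1 - Real.log (v i))), ← h0, ← Finset.sum_add_distrib]
  refine Finset.sum_le_sum fun i hi => ?_
  -- This is the Fenchel inequality for the logarithm; after summation the terms `v i * (l ⬝ᵥ u i)`
  -- cancel by balance.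
  have h := Real.log_le_sub_one_of_pos (mul_pos (hv i hi) (hl i hi))
  rw [Real.log_mul (hv i hi).ne' (hl i hi).ne'] at h
  linarith

/-- Cauchy–Schwarz applied to $|f|\cdot|f|^2$. It trades the cubic Taylor remainders for even
powers, whose expectations can be bounded. -/
lemma sum_abs_pow_three_sq_le (I : Finset κ) (f : κ → ℝ) :
    (∑ i ∈ I, |f i| ^ 3) ^ 2 ≤ (∑ i ∈ I, f i ^ 2) * ∑ i ∈ I, f i ^ 4 := by
  have h := Finset.sum_mul_sq_le_sq_mul_sq I (fun i => |f i|) (fun i => |f i| ^ 2)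
  calc _ = (∑ i ∈ I, |f i| * |f i| ^ 2) ^ 2 := by
        congr 1; exact Finset.sum_congr rfl fun i _ => by ring
    _ ≤ _ := h
    _ = _ := by
        simp only [sq_abs]
        congr 1
        exact Finset.sum_congr rfl fun i _ => by ring

set_option maxHeartbeats 1000000 in
/-- Quadratic expansion of the empirical likelihood ratio statistic, for an array of vectors which
satisfies approximate moment conditions. -/
theorem exists_multiplier_and_abs_sub_le {N : ℝ} (hN : 0 < N) {V : Matrix ι ι ℝ} {C₀ C₁ e P : ℝ}
    (hC₀ : 0 < C₀) (hC₁ : 0 < C₁) (he : 0 < e) (hesmall : e + (2 / C₀ + 1) * e ^ 2 ≤ 1 / 2)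
    (hP : 1 ≤ P) {l₀ : ι → ℝ} (hl₀ : V *ᵥ l₀ = N⁻¹ • ∑ i ∈ I, u i)
    (hV : l₀ ⬝ᵥ (V *ᵥ l₀) ≤ C₁ * (l₀ ⬝ᵥ l₀))
    (hS : ∀ v, C₀ / 2 * (v ⬝ᵥ v) ≤ v ⬝ᵥ (meanOuter I N u *ᵥ v))
    (hρ : N * ((meanOuter I N u *ᵥ l₀ - V *ᵥ l₀) ⬝ᵥ (meanOuter I N u *ᵥ l₀ - V *ᵥ l₀)) ≤ e ^ 4)
    (hF : ∑ i ∈ I, (u i ⬝ᵥ l₀) ^ 4 ≤ e ^ 4) (hQ : e ^ 2 * (N * (l₀ ⬝ᵥ l₀)) ≤ P) :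
    (∃ l, IsELMultiplier I u l) ∧ ∀ l, IsELMultiplier I u l →
      |2 * ∑ i ∈ I, Real.log (1 + l ⬝ᵥ u i) - N * (l₀ ⬝ᵥ (V *ᵥ l₀))|
        ≤ (17 + 16 * C₁ + 34 / C₀) * (√P * e) := by
  classical
  set S := meanOuter I N u with hSdef
  set ub := N⁻¹ • ∑ i ∈ I, u i with hub
  set ρ := S *ᵥ l₀ - V *ᵥ l₀ with hρdef
  set c := 2 / C₀ with hc
  have hc0 : 0 < c := by positivity
  have he1 : e ≤ 1 / 2 := by nlinarith [sq_nonneg e]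
  have hSsymm : ∀ w v, w ⬝ᵥ (S *ᵥ v) = v ⬝ᵥ (S *ᵥ w) := dotProduct_meanOuter_mulVec_comm I N u
  have hSS : ∀ w v, N * (w ⬝ᵥ (S *ᵥ v)) = ∑ i ∈ I, (u i ⬝ᵥ w) * (u i ⬝ᵥ v) := fun w v => by
    rw [hSdef, dotProduct_meanOuter_mulVec, mul_inv_cancel_left₀ hN.ne']
  have hSinj : Function.Injective S.mulVecLin := by
    rw [← LinearMap.ker_eq_bot, LinearMap.ker_eq_bot']
    intro v hv
    have h1 := hS v
    rw [show S *ᵥ v = 0 from hv, dotProduct_zero] at h1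
    have h2 := dotProduct_self_nonneg' v
    exact dotProduct_self_eq_zero.mp (by nlinarith)
  -- The choice `S *ᵥ b = ub` is exactly what makes the weights `1 - u i ⬝ᵥ b` balance the vectors
  -- `u i`.
  obtain ⟨b, hb⟩ := LinearMap.injective_iff_surjective.mp hSinj ub
  replace hb : S *ᵥ b = ub := hb
  set δ := b - l₀ with hδ
  have hbδ : b = l₀ + δ := by rw [hδ]; abel
  have hSδ : S *ᵥ δ = -ρ := by
    rw [hδ, Matrix.mulVec_sub, hb, hρdef, hl₀]
    abel
  -- the size of `δ`
  set G := ∑ i ∈ I, (u i ⬝ᵥ δ) ^ 2 with hG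
  have hGS : G = N * (δ ⬝ᵥ (S *ᵥ δ)) := by
    rw [hSS]
    exact Finset.sum_congr rfl fun i _ => sq _
  have hGρ : G = -(N * (δ ⬝ᵥ ρ)) := by
    rw [hGS, hSδ, dotProduct_neg, mul_neg]
  have hG0 : 0 ≤ G := Finset.sum_nonneg fun i _ => sq_nonneg _
  -- The bound is self-improving: `G` is minus `N * (δ ⬝ᵥ ρ)`, while the lower bound on `S` controls
  -- `N * (δ ⬝ᵥ δ)` by `c * G`. Cauchy–Schwarz gives `G ^ 2 ≤ c * G * e ^ 4`, and one factor `G`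
  -- cancels.
  have hGle : G ≤ c * e ^ 4 := by
    have h1 : N * (δ ⬝ᵥ δ) ≤ c * G := by
      have := hS δ
      rw [hGS, hc]
      have h3 : δ ⬝ᵥ δ ≤ 2 / C₀ * (δ ⬝ᵥ (S *ᵥ δ)) := by
        rw [div_mul_eq_mul_div, le_div_iff₀ hC₀]
        linarith
      nlinarith
    have h2 : G ^ 2 ≤ (N * (δ ⬝ᵥ δ)) * (N * (ρ ⬝ᵥ ρ)) := by
      rw [hGρ, neg_sq]
      have := sq_dotProduct_le δ ρ
      nlinarith [sq_nonneg N]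
    have h3 : 0 ≤ N * (ρ ⬝ᵥ ρ) := mul_nonneg hN.le (dotProduct_self_nonneg' ρ)
    have h4 : G ^ 2 ≤ (c * G) * e ^ 4 :=
      h2.trans (mul_le_mul h1 hρ h3 (by positivity))
    by_contra! h
    nlinarith [h.trans_le' (by positivity : 0 ≤ c * e ^ 4)]
  -- the linear term in `ρ`
  set d := N * (l₀ ⬝ᵥ ρ) with hd
  set T := N * (l₀ ⬝ᵥ (V *ᵥ l₀)) with hT
  have hP0 : 0 < P := by linarith
  have hsq : √P ^ 2 = P := Real.sq_sqrt hP0.le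
  have hs1 : 1 ≤ √P := by rw [Real.one_le_sqrt]; exact hP
  have hdle : |d| ≤ √P * e := by
    refine abs_le_of_sq_le_sq ?_ (by positivity)
    have h2 : d ^ 2 ≤ (N * (l₀ ⬝ᵥ l₀)) * (N * (ρ ⬝ᵥ ρ)) := by
      have := sq_dotProduct_le l₀ ρ
      rw [hd]
      nlinarith [sq_nonneg N]
    have h3 : d ^ 2 ≤ (N * (l₀ ⬝ᵥ l₀)) * e ^ 4 :=
      h2.trans (mul_le_mul_of_nonneg_left hρ (mul_nonneg hN.le (dotProduct_self_nonneg' _)))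
    calc d ^ 2 ≤ e ^ 2 * (e ^ 2 * (N * (l₀ ⬝ᵥ l₀))) := h3.trans_eq (by ring)
      _ ≤ e ^ 2 * P := mul_le_mul_of_nonneg_left hQ (sq_nonneg e)
      _ = (√P * e) ^ 2 := by rw [mul_pow √P, hsq, mul_comm]
  have hH : ∑ i ∈ I, (u i ⬝ᵥ l₀) ^ 2 = T + d := by
    have h1 := hSS l₀ l₀
    have h2 : S *ᵥ l₀ = V *ᵥ l₀ + ρ := by rw [hρdef]; abel
    rw [h2, dotProduct_add, mul_add] at h1
    rw [hT, hd, h1]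
    exact Finset.sum_congr rfl fun i _ => sq _
  -- the cubic terms
  set L3 := ∑ i ∈ I, |u i ⬝ᵥ l₀| ^ 3 with hL3
  have hL30 : 0 ≤ L3 := Finset.sum_nonneg fun i _ => by positivity
  have hL3le : L3 ≤ (C₁ + 1) * (√P * e) := by
    refine le_of_sq_le_sq ?_ (by positivity)
    have h1 := sum_abs_pow_three_sq_le I (fun i => u i ⬝ᵥ l₀)
    rw [hH] at h1
    have hTd0 : 0 ≤ T + d := by rw [← hH]; exact Finset.sum_nonneg fun i _ => sq_nonneg _
    have h2 : L3 ^ 2 ≤ (T + d) * e ^ 4 := h1.trans (mul_le_mul_of_nonneg_left hF hTd0)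
    have h3 : e ^ 2 * T ≤ C₁ * P := by
      have : T ≤ C₁ * (N * (l₀ ⬝ᵥ l₀)) := by
        rw [hT, mul_left_comm]
        exact mul_le_mul_of_nonneg_left hV hN.le
      calc e ^ 2 * T ≤ e ^ 2 * (C₁ * (N * (l₀ ⬝ᵥ l₀))) :=
            mul_le_mul_of_nonneg_left this (sq_nonneg e)
        _ = C₁ * (e ^ 2 * (N * (l₀ ⬝ᵥ l₀))) := by ring
        _ ≤ C₁ * P := mul_le_mul_of_nonneg_left hQ hC₁.le
    have h4 : e ^ 2 * d ≤ P := by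
      have h5 : d ≤ √P * e := (le_abs_self d).trans hdle
      have h6 : √P ≤ P := by nlinarith
      have h7 : e ^ 2 * d ≤ e ^ 2 * (√P * e) := mul_le_mul_of_nonneg_left h5 (sq_nonneg e)
      have h8 : e ^ 3 ≤ 1 := pow_le_one₀ he.le (by linarith)
      calc e ^ 2 * d ≤ √P * e ^ 3 := h7.trans_eq (by ring)
        _ ≤ √P * 1 := mul_le_mul_of_nonneg_left h8 (by positivity)
        _ ≤ P := by rwa [mul_one]
    have h5 : L3 ^ 2 ≤ (C₁ + 1) * (P * e ^ 2) := by
      calc L3 ^ 2 ≤ (e ^ 2 * T + e ^ 2 * d) * e ^ 2 := h2.trans_eq (by ring)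
        _ ≤ (C₁ * P + P) * e ^ 2 :=
          mul_le_mul_of_nonneg_right (add_le_add h3 h4) (sq_nonneg e)
        _ = (C₁ + 1) * (P * e ^ 2) := by ring
    have h6 : ((C₁ + 1) * (√P * e)) ^ 2 = (C₁ + 1) ^ 2 * (P * e ^ 2) := by
      rw [mul_pow (C₁ + 1), mul_pow √P, hsq]
    rw [h6]
    exact h5.trans (mul_le_mul_of_nonneg_right (by nlinarith) (by positivity))
  -- A sum of fourth powers dominates the largest of them, so no separate maximal inequality is
  -- needed to keep the logarithms in the Taylor range.
  have hl0small : ∀ i ∈ I, |u i ⬝ᵥ l₀| ≤ e := by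
    intro i hi
    have h1 : (u i ⬝ᵥ l₀) ^ 4 ≤ e ^ 4 :=
      (Finset.single_le_sum (f := fun i => (u i ⬝ᵥ l₀) ^ 4)
        (fun j _ => by positivity) hi).trans hF
    have h2 : |u i ⬝ᵥ l₀| ^ 4 ≤ e ^ 4 := by
      rwa [Even.pow_abs (by decide)]
    exact le_of_pow_le_pow_left₀ (by norm_num) he.le h2
  have hδsmall : ∀ i ∈ I, |u i ⬝ᵥ δ| ≤ (c + 1) * e ^ 2 := by
    intro i hi
    refine abs_le_of_sq_le_sq ?_ (by positivity)
    have h1 : (u i ⬝ᵥ δ) ^ 2 ≤ G :=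
      Finset.single_le_sum (f := fun i => (u i ⬝ᵥ δ) ^ 2) (fun j _ => sq_nonneg _) hi
    have h2 : 0 < e ^ 4 := by positivity
    nlinarith
  set D3 := ∑ i ∈ I, |u i ⬝ᵥ δ| ^ 3 with hD3
  have hD3le : D3 ≤ G := by
    refine Finset.sum_le_sum fun i hi => ?_
    have h1 : |u i ⬝ᵥ δ| ≤ 1 := (hδsmall i hi).trans (by linarith)
    have h2 := abs_nonneg (u i ⬝ᵥ δ)
    rw [← sq_abs]
    nlinarith [sq_nonneg |u i ⬝ᵥ δ|]
  have hGle' : G ≤ c * (√P * e) := by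
    have h1 : e ^ 4 ≤ e := by
      calc e ^ 4 ≤ e ^ 1 := pow_le_pow_of_le_one he.le (by linarith) (by norm_num)
        _ = e := pow_one e
    have h2 : e ≤ √P * e := by nlinarith
    nlinarith
  have hub_sum : ∀ w, ∑ i ∈ I, u i ⬝ᵥ w = N * (w ⬝ᵥ ub) := by
    intro w
    rw [hub, dotProduct_smul, smul_eq_mul, mul_inv_cancel_left₀ hN.ne', dotProduct_sum]
    exact Finset.sum_congr rfl fun i _ => dotProduct_comm _ _
  -- Exact identity: symmetry of `S` gives `b ⬝ᵥ ub = l₀ ⬝ᵥ ub - b ⬝ᵥ ρ`, and `b = l₀ + δ` splits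
  -- the last term into the contributions of `d` and `G`.
  have hbu : N * (b ⬝ᵥ ub) = T - d + G := by
    have h1 : ub = S *ᵥ l₀ - ρ := by rw [hρdef, ← hl₀]; abel
    have h2 : b ⬝ᵥ ub = l₀ ⬝ᵥ ub - b ⬝ᵥ ρ := by
      conv_lhs => rw [h1]
      rw [dotProduct_sub, hSsymm, hb]
    rw [h2, hGρ, hT, hd, hl₀, hbδ, add_dotProduct]
    ring
  have hbsq : ∑ i ∈ I, (u i ⬝ᵥ b) ^ 2 = N * (b ⬝ᵥ ub) := by
    rw [← hb, hSS]
    exact Finset.sum_congr rfl fun i _ => sq _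
  have hbsmall : ∀ i ∈ I, |u i ⬝ᵥ b| ≤ 1 / 2 := by
    intro i hi
    rw [hbδ, dotProduct_add]
    exact (abs_add_le _ _).trans ((add_le_add (hl0small i hi) (hδsmall i hi)).trans hesmall)
  have hB3 : ∑ i ∈ I, |u i ⬝ᵥ b| ^ 3 ≤ 4 * (L3 + D3) := by
    rw [hL3, hD3, ← Finset.sum_add_distrib, Finset.mul_sum]
    refine Finset.sum_le_sum fun i _ => ?_
    rw [hbδ, dotProduct_add]
    have h1 := abs_nonneg (u i ⬝ᵥ l₀)
    have h2 := abs_nonneg (u i ⬝ᵥ δ)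
    calc _ ≤ (|u i ⬝ᵥ l₀| + |u i ⬝ᵥ δ|) ^ 3 :=
          pow_le_pow_left₀ (abs_nonneg _) (abs_add_le _ _) 3
      _ ≤ 4 * (|u i ⬝ᵥ l₀| ^ 3 + |u i ⬝ᵥ δ| ^ 3) := by
          nlinarith [mul_nonneg (add_nonneg h1 h2) (sq_nonneg (|u i ⬝ᵥ l₀| - |u i ⬝ᵥ δ|))]
  -- the balancing weights
  have hvpos : ∀ i ∈ I, 0 < 1 - u i ⬝ᵥ b := fun i hi => by
    have := (abs_le.mp (hbsmall i hi)).2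
    linarith
  have hvu : ∑ i ∈ I, (1 - u i ⬝ᵥ b) • u i = 0 := by
    simp only [sub_smul, one_smul, Finset.sum_sub_distrib]
    have h1 : N • (S *ᵥ b) = ∑ i ∈ I, (u i ⬝ᵥ b) • u i := by
      rw [hSdef, meanOuter_mulVec, smul_inv_smul₀ hN.ne']
    rw [← h1, hb, hub, smul_inv_smul₀ hN.ne', sub_self]
  refine ⟨exists_isELMultiplier hvpos hvu fun l hl => ?_, fun l hl => ?_⟩
  · have h1 := hS l
    have h2 : N * (l ⬝ᵥ (S *ᵥ l)) = 0 := by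
      rw [hSS]
      refine Finset.sum_eq_zero fun i hi => ?_
      rw [dotProduct_comm, hl i hi, zero_mul]
    have h3 : l ⬝ᵥ (S *ᵥ l) = 0 := (mul_eq_zero.mp h2).resolve_left hN.ne'
    have h4 := dotProduct_self_nonneg' l
    exact dotProduct_self_eq_zero.mp (by nlinarith)
  -- The sandwich: trial multiplier `l₀` from below, balancing weights from above. After doubling,
  -- the bounds are `T - d - 4 * L3` and at most `T - d + G + 16 * (L3 + D3)`.
  · have hlow := hl.sum_log_le (l' := l₀) fun i hi => by
      have := (abs_le.mp (hl0small i hi)).1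
      rw [dotProduct_comm]
      linarith
    have hup := sum_log_le_of_balanced hl.pos hvpos hvu
    have hlow' : ∑ i ∈ I, ((u i ⬝ᵥ l₀) - (u i ⬝ᵥ l₀) ^ 2 / 2 - 2 * |u i ⬝ᵥ l₀| ^ 3)
        ≤ ∑ i ∈ I, Real.log (1 + l₀ ⬝ᵥ u i) := by
      refine Finset.sum_le_sum fun i hi => ?_
      rw [dotProduct_comm l₀]
      have := (abs_le.mp (abs_log_one_add_sub_le ((hl0small i hi).trans he1))).1
      linarith
    have hup' : ∑ i ∈ I, (1 - u i ⬝ᵥ b - 1 - Real.log (1 - u i ⬝ᵥ b))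
        ≤ ∑ i ∈ I, ((u i ⬝ᵥ b) ^ 2 / 2 + 2 * |u i ⬝ᵥ b| ^ 3) := by
      refine Finset.sum_le_sum fun i hi => ?_
      have h1 : |-(u i ⬝ᵥ b)| ≤ 1 / 2 := by rw [abs_neg]; exact hbsmall i hi
      have := (abs_le.mp (abs_log_one_add_sub_le h1)).1
      rw [abs_neg, neg_sq, ← sub_eq_add_neg] at this
      linarith
    rw [Finset.sum_sub_distrib, Finset.sum_sub_distrib, hub_sum, ← Finset.sum_div, hH,
      ← Finset.mul_sum, ← hL3, ← hl₀] at hlow'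
    rw [Finset.sum_add_distrib, ← Finset.sum_div, hbsq, hbu, ← Finset.mul_sum] at hup'
    -- The total error is at most `|d| + 16 * L3 + 17 * G`, because `D3 ≤ G`; the constant collects
    -- the three bounds with `c = 2 / C₀`.
    have hK : (17 + 16 * C₁ + 34 / C₀) * (√P * e)
        = √P * e + 16 * ((C₁ + 1) * (√P * e)) + 17 * (c * (√P * e)) := by
      rw [hc]; ring
    have hd' := abs_le.mp hdle
    have hpe : 0 ≤ c * (√P * e) := by positivity
    have hD30 : 0 ≤ D3 := Finset.sum_nonneg fun i _ => by positivity
    rw [hK, abs_le]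
    constructor <;> linarith

end Deterministic

/-! ### Moments of linear and bilinear forms of independent variables -/

section Moments

variable {Ω κ : Type*} [MeasurableSpace Ω] {μ : Measure Ω} {X : κ → Ω → ℝ}

/-- A function of one member of an independent family is independent of any function of finitely
many other members. -/
lemma indepFun_of_notMem (hX : iIndepFun X μ) (hm : ∀ i, AEMeasurable (X i) μ) {I : Finset κ}
    {a : κ} (ha : a ∉ I) {φ : ℝ → ℝ} (hφ : Measurable φ) {g : (κ → ℝ) → ℝ} (hg : Measurable g)
    (hgI : ∀ x y, (∀ i ∈ I, x i = y i) → g x = g y) :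
    IndepFun (fun ω => φ (X a ω)) (fun ω => g fun i => X i ω) μ := by
  classical
  have h := hX.indepFun_finset₀ {a} I (Finset.disjoint_singleton_left.mpr ha) hm
  -- Extension by zero makes `g` a function of the coordinates in `I` alone, the form in which
  -- independence of disjoint blocks is available.
  let ext : (I → ℝ) → κ → ℝ := fun v i => if hi : i ∈ I then v ⟨i, hi⟩ else 0
  have hext : Measurable ext := by
    refine measurable_pi_lambda _ fun i => ?_
    by_cases hi : i ∈ I
    · simpa [ext, hi] using measurable_pi_apply _
    · simp [ext, hi]
  have h' := h.comp (φ := fun v : ({a} : Finset κ) → ℝ => φ (v ⟨a, Finset.mem_singleton_self a⟩))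
    (ψ := fun v => g (ext v)) (hφ.comp (measurable_pi_apply _)) (hg.comp hext)
  have e : (fun v => g (ext v)) ∘ (fun ω (i : I) => X i ω) = fun ω => g fun i => X i ω := by
    ext ω
    refine hgI _ _ fun i hi => ?_
    simp [ext, hi]
  rwa [e] at h'

lemma integrable_mul_and_integral_mul (hX : iIndepFun X μ) (hm : ∀ i, AEMeasurable (X i) μ)
    {I : Finset κ} {a : κ} (ha : a ∉ I) {φ : ℝ → ℝ} (hφ : Measurable φ) {g : (κ → ℝ) → ℝ}
    (hg : Measurable g) (hgI : ∀ x y, (∀ i ∈ I, x i = y i) → g x = g y)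
    (hφi : Integrable (fun ω => φ (X a ω)) μ) (hgi : Integrable (fun ω => g fun i => X i ω) μ) :
    Integrable (fun ω => φ (X a ω) * g fun i => X i ω) μ ∧
      ∫ ω, φ (X a ω) * g (fun i => X i ω) ∂μ
        = (∫ ω, φ (X a ω) ∂μ) * ∫ ω, g (fun i => X i ω) ∂μ :=
  have h := indepFun_of_notMem hX hm ha hφ hg hgI
  ⟨h.integrable_mul hφi hgi, h.integral_fun_mul_eq_mul_integral hφi.1 hgi.1⟩

lemma memLp_sum_mul {m : ENNReal} (hL : ∀ i, MemLp (X i) m μ) (I : Finset κ) (a : κ → ℝ) :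
    MemLp (fun ω => ∑ i ∈ I, a i * X i ω) m μ :=
  memLp_finsetSum _ fun i _ => (hL i).const_mul (a i)

lemma integral_sum_mul_eq_zero (hL : ∀ i, Integrable (X i) μ) (h0 : ∀ i, ∫ ω, X i ω ∂μ = 0)
    (I : Finset κ) (a : κ → ℝ) : ∫ ω, ∑ i ∈ I, a i * X i ω ∂μ = 0 := by
  rw [integral_finsetSum _ fun i _ => (hL i).const_mul (a i)]
  exact Finset.sum_eq_zero fun i _ => by rw [integral_const_mul, h0, mul_zero]

lemma integral_add_three {f₁ f₂ f₃ : Ω → ℝ} (h₁ : Integrable f₁ μ) (h₂ : Integrable f₂ μ)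
    (h₃ : Integrable f₃ μ) :
    ∫ ω, f₁ ω + f₂ ω + f₃ ω ∂μ = ∫ ω, f₁ ω ∂μ + ∫ ω, f₂ ω ∂μ + ∫ ω, f₃ ω ∂μ := by
  rw [← integral_add h₁ h₂]
  exact integral_add (h₁.add h₂) h₃

lemma integral_add_five {f₁ f₂ f₃ f₄ f₅ : Ω → ℝ} (h₁ : Integrable f₁ μ) (h₂ : Integrable f₂ μ)
    (h₃ : Integrable f₃ μ) (h₄ : Integrable f₄ μ) (h₅ : Integrable f₅ μ) :
    ∫ ω, f₁ ω + f₂ ω + f₃ ω + f₄ ω + f₅ ω ∂μ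
      = ∫ ω, f₁ ω ∂μ + ∫ ω, f₂ ω ∂μ + ∫ ω, f₃ ω ∂μ + ∫ ω, f₄ ω ∂μ + ∫ ω, f₅ ω ∂μ := by
  rw [← integral_add_three h₁ h₂ h₃]
  exact integral_add_three ((h₁.add h₂).add h₃) h₄ h₅

variable [IsProbabilityMeasure μ]

lemma integrable_pow_of_memLp {f : Ω → ℝ} {m k : ℕ} (hf : MemLp f m μ) (hk : k ≤ m) :
    Integrable (fun ω => f ω ^ k) μ := by
  have h : MemLp f k μ := hf.mono_exponent (by exact_mod_cast hk)
  have h1 := h.integrable_norm_pow'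
  refine (integrable_norm_iff (hf.1.pow k)).mp ?_
  simpa using h1

lemma integral_sq_sum_mul (hX : iIndepFun X μ) (hL : ∀ i, MemLp (X i) 2 μ)
    (h0 : ∀ i, ∫ ω, X i ω ∂μ = 0) {v : ℝ} (hv : ∀ i, ∫ ω, X i ω ^ 2 ∂μ = v) (I : Finset κ)
    (a : κ → ℝ) : ∫ ω, (∑ i ∈ I, a i * X i ω) ^ 2 ∂μ = v * ∑ i ∈ I, a i ^ 2 := by
  classical
  have hm : ∀ i, AEMeasurable (X i) μ := fun i => (hL i).1.aemeasurable
  induction I using Finset.induction_on with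
  | empty => simp
  | insert j I hj ih =>
    have hS := memLp_sum_mul hL I a
    have hSi : Integrable (fun ω => ∑ i ∈ I, a i * X i ω) μ := hS.integrable (by norm_num)
    have hXi : ∀ i, Integrable (X i) μ := fun i => (hL i).integrable (by norm_num)
    obtain ⟨i1, e1⟩ := integrable_mul_and_integral_mul hX hm hj (φ := fun x => x)
      (g := fun x => ∑ i ∈ I, a i * x i) measurable_id (by fun_prop)
      (fun x y h => Finset.sum_congr rfl fun i hi => by rw [h i hi]) (hXi j) hSi
    rw [h0, zero_mul] at e1
    calc _ = ∫ ω, (∑ i ∈ I, a i * X i ω) ^ 2 + (2 * a j) * (X j ω * ∑ i ∈ I, a i * X i ω)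
              + a j ^ 2 * X j ω ^ 2 ∂μ := by
            congr 1
            ext ω
            rw [Finset.sum_insert hj]
            ring
      _ = _ := by
        rw [integral_add_three hS.integrable_sq (i1.const_mul _)
          ((hL j).integrable_sq.const_mul _), integral_const_mul, integral_const_mul, e1, ih, hv, Finset.sum_insert hj]
        ring

/-- Adding one variable to the sum, the terms containing either part to the first power vanish by
centering. What remains besides the old fourth moment is $6a_j^2v^2s+a_j^4m$ with $s=\sum a_i^2$,
and $v^2\le m$ lets this fit into the growth of $3ms^2$ when $s$ becomes $s+a_j^2$. -/
lemma integral_pow_four_sum_mul_le (hX : iIndepFun X μ) (hL : ∀ i, MemLp (X i) 4 μ)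
    (h0 : ∀ i, ∫ ω, X i ω ∂μ = 0) {v m : ℝ} (hv : ∀ i, ∫ ω, X i ω ^ 2 ∂μ = v)
    (hm4 : ∀ i, ∫ ω, X i ω ^ 4 ∂μ = m) (hvm : v ^ 2 ≤ m) (I : Finset κ) (a : κ → ℝ) :
    ∫ ω, (∑ i ∈ I, a i * X i ω) ^ 4 ∂μ ≤ 3 * m * (∑ i ∈ I, a i ^ 2) ^ 2 := by
  classical
  have hm : ∀ i, AEMeasurable (X i) μ := fun i => (hL i).1.aemeasurable
  have hL2 : ∀ i, MemLp (X i) 2 μ := fun i => (hL i).mono_exponent (by norm_num)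
  have hL1 : ∀ i, Integrable (X i) μ := fun i => (hL2 i).integrable (by norm_num)
  induction I using Finset.induction_on with
  | empty => simp
  | insert j I hj ih =>
    have hS := memLp_sum_mul hL I a
    have hpow : ∀ k ≤ 4, Integrable (fun ω => (∑ i ∈ I, a i * X i ω) ^ k) μ := fun k hk =>
      integrable_pow_of_memLp (m := 4) hS hk
    have hpowX : ∀ k ≤ 4, Integrable (fun ω => X j ω ^ k) μ := fun k hk =>
      integrable_pow_of_memLp (m := 4) (hL j) hk
    have key : ∀ k ≤ 4, ∀ l ≤ 4,
        Integrable (fun ω => X j ω ^ k * (∑ i ∈ I, a i * X i ω) ^ l) μ ∧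
        ∫ ω, X j ω ^ k * (∑ i ∈ I, a i * X i ω) ^ l ∂μ
          = (∫ ω, X j ω ^ k ∂μ) * ∫ ω, (∑ i ∈ I, a i * X i ω) ^ l ∂μ := fun k hk l hl =>
      integrable_mul_and_integral_mul hX hm hj (φ := fun x => x ^ k)
        (g := fun x => (∑ i ∈ I, a i * x i) ^ l) (by fun_prop) (by fun_prop)
        (fun x y h => by rw [Finset.sum_congr rfl fun i hi => by rw [h i hi]])
        (hpowX k hk) (hpow l hl)
    obtain ⟨i1, e1⟩ := key 1 (by norm_num) 3 (by norm_num)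
    obtain ⟨i2, e2⟩ := key 2 (by norm_num) 2 (by norm_num)
    obtain ⟨i3, e3⟩ := key 3 (by norm_num) 1 (by norm_num)
    simp only [pow_one] at i1 e1 i3 e3
    rw [h0, zero_mul] at e1
    rw [integral_sum_mul_eq_zero hL1 h0, mul_zero] at e3
    rw [hv, integral_sq_sum_mul hX hL2 h0 hv] at e2
    set s := ∑ i ∈ I, a i ^ 2 with hs
    have hs0 : 0 ≤ s := Finset.sum_nonneg fun i _ => sq_nonneg _
    have hm0 : 0 ≤ m := (sq_nonneg v).trans hvm
    calc _ = ∫ ω, (∑ i ∈ I, a i * X i ω) ^ 4 + (4 * a j) * (X j ω * (∑ i ∈ I, a i * X i ω) ^ 3)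
              + (6 * a j ^ 2) * (X j ω ^ 2 * (∑ i ∈ I, a i * X i ω) ^ 2)
              + (4 * a j ^ 3) * (X j ω ^ 3 * (∑ i ∈ I, a i * X i ω))
              + a j ^ 4 * X j ω ^ 4 ∂μ := by
            congr 1
            ext ω
            rw [Finset.sum_insert hj]
            ring
      _ = (∫ ω, (∑ i ∈ I, a i * X i ω) ^ 4 ∂μ) + 6 * a j ^ 2 * (v * (v * s)) + a j ^ 4 * m := by
        have hS4 := hpow 4 le_rfl
        have j1 := i1.const_mul (4 * a j)
        have j2 := i2.const_mul (6 * a j ^ 2)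
        have j3 := i3.const_mul (4 * a j ^ 3)
        have j4 := (hpowX 4 le_rfl).const_mul (a j ^ 4)
        rw [integral_add_five hS4 j1 j2 j3 j4]
        simp only [integral_const_mul]
        rw [e1, e2, e3, hm4]
        ring
      _ ≤ 3 * m * s ^ 2 + 6 * a j ^ 2 * (m * s) + 3 * a j ^ 4 * m := by
        have h1 : v * (v * s) ≤ m * s := by
          rw [← mul_assoc, ← sq]
          exact mul_le_mul_of_nonneg_right hvm hs0
        have h2 := mul_le_mul_of_nonneg_left h1 (by positivity : 0 ≤ 6 * a j ^ 2)
        have h3 : 0 ≤ a j ^ 4 * m := by positivity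
        linarith
      _ = _ := by
        rw [Finset.sum_insert hj, ← hs]
        ring

/-- Off the diagonal the form is degenerate: a new index `a` contributes $\varphi(X_a)L+X_aR$ with
$L$, $R$ and the old form independent of $X_a$, so the cross terms with the old form vanish. The
factor 2 comes from $(A+B)^2\le2A^2+2B^2$, since $\varphi(X_a)$ and $X_a$ may be correlated. -/
lemma integral_sq_bilinear_le (hX : iIndepFun X μ) (hL : ∀ i, MemLp (X i) 2 μ)
    (h0 : ∀ i, ∫ ω, X i ω ∂μ = 0) {v : ℝ} (hv : ∀ i, ∫ ω, X i ω ^ 2 ∂μ = v)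
    {φ : ℝ → ℝ} (hφ : Measurable φ) (hLφ : ∀ i, MemLp (fun ω => φ (X i ω)) 2 μ)
    (h0φ : ∀ i, ∫ ω, φ (X i ω) ∂μ = 0) {w : ℝ} (hw : ∀ i, ∫ ω, φ (X i ω) ^ 2 ∂μ = w)
    {b : κ → κ → ℝ} (hb : ∀ i, b i i = 0) (I : Finset κ) :
    MemLp (fun ω => ∑ i ∈ I, ∑ j ∈ I, b i j * (φ (X i ω) * X j ω)) 2 μ ∧
    ∫ ω, (∑ i ∈ I, ∑ j ∈ I, b i j * (φ (X i ω) * X j ω)) ^ 2 ∂μ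
      ≤ 2 * w * v * ∑ i ∈ I, ∑ j ∈ I, b i j ^ 2 := by
  classical
  have hm : ∀ i, AEMeasurable (X i) μ := fun i => (hL i).1.aemeasurable
  have hXφ : iIndepFun (fun i ω => φ (X i ω)) μ := hX.comp (fun _ => φ) fun _ => hφ
  induction I using Finset.induction_on with
  | empty => simp
  | insert a I ha ih =>
    obtain ⟨hQ, ih⟩ := ih
    have hLm : MemLp (fun ω => ∑ j ∈ I, b a j * X j ω) 2 μ := memLp_sum_mul hL I _
    have hMm : MemLp (fun ω => ∑ i ∈ I, b i a * φ (X i ω)) 2 μ := memLp_sum_mul hLφ I _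
    have hXi : ∀ i, Integrable (X i) μ := fun i => (hL i).integrable (by norm_num)
    have hφi : ∀ i, Integrable (fun ω => φ (X i ω)) μ := fun i => (hLφ i).integrable (by norm_num)
    have hsplit : ∀ ω, ∑ i ∈ insert a I, ∑ j ∈ insert a I, b i j * (φ (X i ω) * X j ω)
        = (∑ i ∈ I, ∑ j ∈ I, b i j * (φ (X i ω) * X j ω))
          + φ (X a ω) * (∑ j ∈ I, b a j * X j ω) + X a ω * ∑ i ∈ I, b i a * φ (X i ω) := by
      intro ω
      simp only [Finset.sum_insert ha, Finset.sum_add_distrib, hb, zero_mul, zero_add,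
        Finset.mul_sum]
      simp only [mul_left_comm (X a ω), mul_left_comm (φ (X a ω)) (b a _),
        mul_comm (X a ω) (φ _)]
      ring
    have hQI : ∀ x y : κ → ℝ, (∀ i ∈ I, x i = y i) →
        ∑ i ∈ I, ∑ j ∈ I, b i j * (φ (x i) * x j) = ∑ i ∈ I, ∑ j ∈ I, b i j * (φ (y i) * y j) :=
      fun x y h => Finset.sum_congr rfl fun i hi => Finset.sum_congr rfl fun j hj => by
        rw [h i hi, h j hj]
    have hLI : ∀ x y : κ → ℝ, (∀ i ∈ I, x i = y i) →
        ∑ j ∈ I, b a j * x j = ∑ j ∈ I, b a j * y j :=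
      fun x y h => Finset.sum_congr rfl fun j hj => by rw [h j hj]
    have hMI : ∀ x y : κ → ℝ, (∀ i ∈ I, x i = y i) →
        ∑ j ∈ I, b j a * φ (x j) = ∑ j ∈ I, b j a * φ (y j) :=
      fun x y h => Finset.sum_congr rfl fun j hj => by rw [h j hj]
    obtain ⟨i1, e1⟩ := integrable_mul_and_integral_mul hX hm ha (φ := fun x => φ x ^ 2)
      (g := fun x => (∑ j ∈ I, b a j * x j) ^ 2) (by fun_prop) (by fun_prop)
      (fun x y h => by rw [hLI x y h]) (hLφ a).integrable_sq hLm.integrable_sq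
    obtain ⟨i2, e2⟩ := integrable_mul_and_integral_mul hX hm ha (φ := fun x => x ^ 2)
      (g := fun x => (∑ j ∈ I, b j a * φ (x j)) ^ 2) (by fun_prop) (by fun_prop)
      (fun x y h => by rw [hMI x y h]) (hL a).integrable_sq hMm.integrable_sq
    obtain ⟨i3, e3⟩ := integrable_mul_and_integral_mul hX hm ha (φ := φ)
      (g := fun x => (∑ i ∈ I, ∑ j ∈ I, b i j * (φ (x i) * x j)) * ∑ j ∈ I, b a j * x j)
      hφ (by fun_prop)
      (fun x y h => by rw [hLI x y h, hQI x y h]) (hφi a) (hQ.integrable_mul hLm)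
    obtain ⟨i4, e4⟩ := integrable_mul_and_integral_mul hX hm ha (φ := fun x => x)
      (g := fun x => (∑ i ∈ I, ∑ j ∈ I, b i j * (φ (x i) * x j)) * ∑ j ∈ I, b j a * φ (x j))
      measurable_id (by fun_prop)
      (fun x y h => by rw [hMI x y h, hQI x y h]) (hXi a) (hQ.integrable_mul hMm)
    rw [hw, integral_sq_sum_mul hX hL h0 hv] at e1
    rw [hv, integral_sq_sum_mul hXφ hLφ h0φ hw] at e2
    rw [h0φ, zero_mul] at e3
    rw [h0, zero_mul] at e4
    simp only [hsplit]
    have m1 : MemLp (fun ω => φ (X a ω) * ∑ j ∈ I, b a j * X j ω) 2 μ :=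
      (memLp_two_iff_integrable_sq ((hφi a).1.mul hLm.1)).mpr (by
        simpa only [Pi.mul_apply, mul_pow] using i1)
    have m2 : MemLp (fun ω => X a ω * ∑ i ∈ I, b i a * φ (X i ω)) 2 μ :=
      (memLp_two_iff_integrable_sq ((hXi a).1.mul hMm.1)).mpr (by
        simpa only [Pi.mul_apply, mul_pow] using i2)
    have m3 := (hQ.add m1).add m2
    refine ⟨m3, ?_⟩
    have j1 := i1.const_mul 2
    have j2 := i2.const_mul 2
    have j3 := i3.const_mul 2
    have j4 := i4.const_mul 2
    calc _ ≤ ∫ ω, (∑ i ∈ I, ∑ j ∈ I, b i j * (φ (X i ω) * X j ω)) ^ 2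
            + 2 * (φ (X a ω) ^ 2 * (∑ j ∈ I, b a j * X j ω) ^ 2)
            + 2 * (X a ω ^ 2 * (∑ i ∈ I, b i a * φ (X i ω)) ^ 2)
            + 2 * (φ (X a ω) * ((∑ i ∈ I, ∑ j ∈ I, b i j * (φ (X i ω) * X j ω))
              * ∑ j ∈ I, b a j * X j ω))
            + 2 * (X a ω * ((∑ i ∈ I, ∑ j ∈ I, b i j * (φ (X i ω) * X j ω))
              * ∑ i ∈ I, b i a * φ (X i ω))) ∂μ := by
          refine integral_mono m3.integrable_sq
            ((((hQ.integrable_sq.add j1).add j2).add j3).add j4) fun ω => ?_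
          dsimp only
          generalize (∑ i ∈ I, ∑ j ∈ I, b i j * (φ (X i ω) * X j ω)) = Q
          generalize (∑ j ∈ I, b a j * X j ω) = L
          generalize (∑ i ∈ I, b i a * φ (X i ω)) = R
          nlinarith [sq_nonneg (φ (X a ω) * L - X a ω * R)]
      _ = (∫ ω, (∑ i ∈ I, ∑ j ∈ I, b i j * (φ (X i ω) * X j ω)) ^ 2 ∂μ)
            + 2 * (w * (v * ∑ j ∈ I, b a j ^ 2)) + 2 * (v * (w * ∑ i ∈ I, b i a ^ 2)) := by
          rw [integral_add_five hQ.integrable_sq j1 j2 j3 j4]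
          simp only [integral_const_mul]
          rw [e1, e2, e3, e4]
          ring
      _ ≤ 2 * w * v * (∑ i ∈ I, ∑ j ∈ I, b i j ^ 2)
            + 2 * (w * (v * ∑ j ∈ I, b a j ^ 2)) + 2 * (v * (w * ∑ i ∈ I, b i a ^ 2)) := by
          gcongr
      _ = _ := by
          simp only [Finset.sum_insert ha, Finset.sum_add_distrib, hb]
          ring

end Moments

/-! ### Moment bounds for the score vectors of a linear model with fixed design -/

section Design

variable {κ ι : Type*} [Fintype ι]

/-- A fixed design `x` of size `N`, with bounds `C₀`, `C₁` for the eigenvalues of the matrix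
`V = v • meanOuter I N x` and `D` for the squared lengths; `y i` is `V⁻¹ x i`. -/
structure IsRegularDesign (I : Finset κ) (N v C₀ C₁ D : ℝ) (x y : κ → ι → ℝ) : Prop where
  card : (I.card : ℝ) = N
  N_pos : 0 < N
  v_pos : 0 < v
  C₀_pos : 0 < C₀
  C₁_pos : 0 < C₁
  lower : ∀ b, C₀ * (b ⬝ᵥ b) ≤ b ⬝ᵥ ((v • meanOuter I N x) *ᵥ b)
  upper : ∀ b, b ⬝ᵥ ((v • meanOuter I N x) *ᵥ b) ≤ C₁ * (b ⬝ᵥ b)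
  norm_le : ∀ i ∈ I, x i ⬝ᵥ x i ≤ D
  solve : ∀ i, (v • meanOuter I N x) *ᵥ y i = x i

namespace IsRegularDesign

variable {I : Finset κ} {N v C₀ C₁ D : ℝ} {x y : κ → ι → ℝ}

lemma D_nonneg (h : IsRegularDesign I N v C₀ C₁ D x y) : 0 ≤ D := by
  have h1 : 0 < (I.card : ℝ) := by rw [h.card]; exact h.N_pos
  obtain ⟨i, hi⟩ := Finset.card_pos.mp (Nat.cast_pos.mp h1)
  exact (dotProduct_self_nonneg' _).trans (h.norm_le i hi)

lemma quadratic (h : IsRegularDesign I N v C₀ C₁ D x y) (b : ι → ℝ) :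
    ∑ j ∈ I, (x j ⬝ᵥ b) ^ 2 = N / v * (b ⬝ᵥ ((v • meanOuter I N x) *ᵥ b)) := by
  rw [Matrix.smul_mulVec, dotProduct_smul, dotProduct_meanOuter_mulVec, smul_eq_mul]
  have := h.N_pos.ne'
  have := h.v_pos.ne'
  field_simp

lemma gram_symm (h : IsRegularDesign I N v C₀ C₁ D x y) (i j : κ) :
    x i ⬝ᵥ y j = x j ⬝ᵥ y i := by
  rw [← h.solve i, ← h.solve j, dotProduct_comm, dotProduct_comm _ (y i), Matrix.smul_mulVec,
    Matrix.smul_mulVec, dotProduct_smul, dotProduct_smul, dotProduct_meanOuter_mulVec_comm]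

/-- With $Vy=x$ the spectral lower bound reads $C_0|y|^2\le x^ty$, and Cauchy–Schwarz bounds $x^ty$
by $|x||y|$; combining the two bounds both quantities. -/
lemma solve_sq_le (h : IsRegularDesign I N v C₀ C₁ D x y) {i : κ} (hi : i ∈ I) :
    y i ⬝ᵥ y i ≤ D / C₀ ^ 2 ∧ 0 ≤ x i ⬝ᵥ y i ∧ x i ⬝ᵥ y i ≤ D / C₀ := by
  have h1 := h.lower (y i)
  rw [h.solve i, dotProduct_comm _ (x i)] at h1
  have h2 := sq_dotProduct_le (x i) (y i)
  have h3 := dotProduct_self_nonneg' (y i)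
  have h4 := h.norm_le i hi
  have hC := h.C₀_pos
  have hD := h.D_nonneg
  set g := x i ⬝ᵥ y i
  set a := y i ⬝ᵥ y i
  have hg : 0 ≤ g := le_trans (by positivity) h1
  have h5 : g ^ 2 ≤ D * a := h2.trans (mul_le_mul_of_nonneg_right h4 h3)
  have hgle : g ≤ D / C₀ := by
    rw [le_div_iff₀ hC]
    by_contra! hlt
    have hgpos : 0 < g := by
      by_contra! h0
      nlinarith
    have : C₀ * g ^ 2 ≤ D * g := by nlinarith
    nlinarith
  refine ⟨?_, hg, hgle⟩
  rw [le_div_iff₀ (by positivity)]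
  rw [le_div_iff₀ hC] at hgle
  nlinarith

/-- Since $\sum_jx_jx_j^t=(N/v)V$, the row sum collapses to $(N/v)\,x_i^tV^{-1}x_i$. This is linear
in `D`, whereas bounding each entry separately would give `D ^ 2`; the saved factor is what permits
a rate $p^2/n$. -/
lemma gram_sq_sum_le (h : IsRegularDesign I N v C₀ C₁ D x y) {i : κ} (hi : i ∈ I) :
    ∑ j ∈ I, (x i ⬝ᵥ y j) ^ 2 ≤ N * D / (v * C₀) := by
  have h1 := h.quadratic (y i)
  rw [h.solve i, dotProduct_comm (y i)] at h1
  simp only [h.gram_symm i]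
  rw [h1]
  have h2 := (h.solve_sq_le hi).2.2
  have := h.N_pos
  have := h.v_pos
  calc N / v * (x i ⬝ᵥ y i) ≤ N / v * (D / C₀) := by gcongr
    _ = _ := by rw [div_mul_div_comm]

/-- The matrix with columns $x_i$ has squared operator norm at most $NC_1/v$, by duality with
`quadratic`. It is used for coefficients that need not be centered, where variance computations give
nothing. -/
lemma sum_smul_sq_le (h : IsRegularDesign I N v C₀ C₁ D x y) (ξ : κ → ℝ) :
    (∑ i ∈ I, ξ i • x i) ⬝ᵥ (∑ i ∈ I, ξ i • x i) ≤ N * C₁ / v * ∑ i ∈ I, ξ i ^ 2 := by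
  set g := ∑ i ∈ I, ξ i • x i with hg
  have hN := h.N_pos
  have hv := h.v_pos
  have hC := h.C₁_pos
  have h1 : g ⬝ᵥ g = ∑ i ∈ I, ξ i * (x i ⬝ᵥ g) := by
    conv_lhs => rw [hg, sum_dotProduct]
    exact Finset.sum_congr rfl fun i _ => by rw [smul_dotProduct, smul_eq_mul]
  have h2 := Finset.sum_mul_sq_le_sq_mul_sq I ξ fun i => x i ⬝ᵥ g
  rw [← h1, h.quadratic g] at h2
  have h3 : N / v * (g ⬝ᵥ ((v • meanOuter I N x) *ᵥ g)) ≤ N / v * (C₁ * (g ⬝ᵥ g)) :=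
    mul_le_mul_of_nonneg_left (h.upper g) (by positivity)
  have h4 := dotProduct_self_nonneg' g
  have h5 : 0 ≤ ∑ i ∈ I, ξ i ^ 2 := Finset.sum_nonneg fun i _ => sq_nonneg _
  have h6 : (g ⬝ᵥ g) ^ 2 ≤ (N * C₁ / v * ∑ i ∈ I, ξ i ^ 2) * (g ⬝ᵥ g) := by
    refine h2.trans ((mul_le_mul_of_nonneg_left h3 h5).trans_eq ?_)
    ring
  have h7 : 0 ≤ N * C₁ / v * ∑ i ∈ I, ξ i ^ 2 := by positivity
  by_contra! hlt
  nlinarith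

end IsRegularDesign

/-- The Frobenius norm dominates the operator norm, and unlike the latter it has an explicit
expectation. -/
lemma quadratic_form_sq_le (A : Matrix ι ι ℝ) (b : ι → ℝ) :
    (b ⬝ᵥ (A *ᵥ b)) ^ 2 ≤ (∑ r, ∑ s, A r s ^ 2) * (b ⬝ᵥ b) ^ 2 := by
  have h1 := sq_dotProduct_le b (A *ᵥ b)
  have h2 : (A *ᵥ b) ⬝ᵥ (A *ᵥ b) ≤ (∑ r, ∑ s, A r s ^ 2) * (b ⬝ᵥ b) := by
    rw [Finset.sum_mul]
    refine Finset.sum_le_sum fun r _ => ?_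
    have := sq_dotProduct_le (A r) b
    rw [← sq]
    refine this.trans_eq ?_
    simp only [dotProduct, sq]
  have h3 := mul_le_mul_of_nonneg_left h2 (dotProduct_self_nonneg' b)
  refine h1.trans (h3.trans_eq (by ring))

end Design

section Errors

variable {Ω κ ι : Type*} [MeasurableSpace Ω] {μ : Measure Ω} [IsProbabilityMeasure μ] [Fintype ι]

/-- A sequence of centered independent variables with prescribed moments. -/
structure IsErrorSequence (X : κ → Ω → ℝ) (μ : Measure Ω) (v w m₄ m₆ m₈ : ℝ) : Prop where
  indep : iIndepFun X μ
  memLp : ∀ i, MemLp (X i) 8 μ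
  mean : ∀ i, ∫ ω, X i ω ∂μ = 0
  second : ∀ i, ∫ ω, X i ω ^ 2 ∂μ = v
  fourth : ∀ i, ∫ ω, X i ω ^ 4 ∂μ = m₄
  sixth : ∀ i, ∫ ω, ((X i ω ^ 2 - v) * X i ω) ^ 2 ∂μ = m₆
  eighth : ∀ i, ∫ ω, X i ω ^ 8 ∂μ = m₈
  centered_sq : ∀ i, ∫ ω, (X i ω ^ 2 - v) ^ 2 ∂μ = w

namespace IsErrorSequence

variable {X : κ → Ω → ℝ} {v w m₄ m₆ m₈ : ℝ}

lemma integrable_pow (h : IsErrorSequence X μ v w m₄ m₆ m₈) (i : κ) {k : ℕ} (hk : k ≤ 8) :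
    Integrable (fun ω => X i ω ^ k) μ :=
  integrable_pow_of_memLp (m := 8) (h.memLp i) hk

lemma memLp_two (h : IsErrorSequence X μ v w m₄ m₆ m₈) (i : κ) : MemLp (X i) 2 μ :=
  (h.memLp i).mono_exponent (by norm_num)

lemma memLp_four (h : IsErrorSequence X μ v w m₄ m₆ m₈) (i : κ) : MemLp (X i) 4 μ :=
  (h.memLp i).mono_exponent (by norm_num)

omit [IsProbabilityMeasure μ] in
lemma aestronglyMeasurable (h : IsErrorSequence X μ v w m₄ m₆ m₈) (i : κ) :
    AEStronglyMeasurable (X i) μ := (h.memLp i).1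

lemma memLp_centered_sq (h : IsErrorSequence X μ v w m₄ m₆ m₈) (i : κ) :
    MemLp (fun ω => X i ω ^ 2 - v) 2 μ := by
  refine (memLp_two_iff_integrable_sq
    (((h.aestronglyMeasurable i).pow 2).sub aestronglyMeasurable_const)).mpr ?_
  have e : (fun ω => (X i ω ^ 2 - v) ^ 2) =
      fun ω => X i ω ^ 4 - 2 * v * X i ω ^ 2 + v ^ 2 := by
    ext ω
    ring
  change Integrable (fun ω => (X i ω ^ 2 - v) ^ 2) μ
  rw [e]
  exact ((h.integrable_pow i (by norm_num)).sub
    ((h.integrable_pow i (by norm_num)).const_mul _)).add (integrable_const _)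

lemma integrable_sixth (h : IsErrorSequence X μ v w m₄ m₆ m₈) (i : κ) :
    Integrable (fun ω => ((X i ω ^ 2 - v) * X i ω) ^ 2) μ := by
  have e : (fun ω => ((X i ω ^ 2 - v) * X i ω) ^ 2) =
      fun ω => X i ω ^ 6 - 2 * v * X i ω ^ 4 + v ^ 2 * X i ω ^ 2 := by
    ext ω
    ring
  rw [e]
  exact ((h.integrable_pow i (by norm_num)).sub
    ((h.integrable_pow i (by norm_num)).const_mul _)).add
      ((h.integrable_pow i (by norm_num)).const_mul _)

lemma integral_centered (h : IsErrorSequence X μ v w m₄ m₆ m₈) (i : κ) :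
    ∫ ω, (X i ω ^ 2 - v) ∂μ = 0 := by
  rw [integral_sub (h.integrable_pow i (by norm_num)) (integrable_const _), h.second]
  simp

lemma sq_second_le (h : IsErrorSequence X μ v w m₄ m₆ m₈) (i : κ) : v ^ 2 ≤ m₄ := by
  have h1 : 0 ≤ ∫ ω, (X i ω ^ 2 - v) ^ 2 ∂μ := integral_nonneg fun ω => sq_nonneg _
  have e : (fun ω => (X i ω ^ 2 - v) ^ 2) =
      fun ω => X i ω ^ 4 + (-(2 * v)) * X i ω ^ 2 + v ^ 2 := by
    ext ω
    ring
  rw [e, integral_add_three (h.integrable_pow i (by norm_num))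
    ((h.integrable_pow i (by norm_num)).const_mul _) (integrable_const _), integral_const_mul,
    h.second, h.fourth] at h1
  simp only [integral_const, probReal_univ, one_smul] at h1
  linarith

/-- Fourth moments of the products of one variable with a linear form. -/
lemma integral_pow_four_mul_le (h : IsErrorSequence X μ v w m₄ m₆ m₈) {I : Finset κ} {i : κ}
    (hi : i ∈ I) (a : κ → ℝ) :
    Integrable (fun ω => (X i ω * ∑ j ∈ I, a j * X j ω) ^ 4) μ ∧
    ∫ ω, (X i ω * ∑ j ∈ I, a j * X j ω) ^ 4 ∂μ
      ≤ 8 * m₈ * a i ^ 4 + 24 * m₄ ^ 2 * (∑ j ∈ I, a j ^ 2) ^ 2 := by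
  classical
  have hm : ∀ i, AEMeasurable (X i) μ := fun i => (h.aestronglyMeasurable i).aemeasurable
  have hS := memLp_sum_mul h.memLp_four (I.erase i) a
  have hSm := memLp_sum_mul h.memLp_four I a
  -- Removing the index `i` from the linear form leaves a factor independent of `X i`; the removed
  -- term produces the eighth moment.
  obtain ⟨i1, e1⟩ := integrable_mul_and_integral_mul h.indep hm (Finset.notMem_erase i I)
    (φ := fun t => t ^ 4) (g := fun z => (∑ j ∈ I.erase i, a j * z j) ^ 4) (by fun_prop)
    (by fun_prop) (fun x y h => by rw [Finset.sum_congr rfl fun i hi => by rw [h i hi]])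
    (h.integrable_pow i (by norm_num)) (integrable_pow_of_memLp (m := 4) hS le_rfl)
  have h8 := (h.integrable_pow i le_rfl).const_mul (8 * a i ^ 4)
  have hdom : ∀ ω, (X i ω * ∑ j ∈ I, a j * X j ω) ^ 4 ≤
      8 * a i ^ 4 * X i ω ^ 8 + 8 * (X i ω ^ 4 * (∑ j ∈ I.erase i, a j * X j ω) ^ 4) := by
    intro ω
    rw [← Finset.add_sum_erase I _ hi]
    generalize ∑ j ∈ I.erase i, a j * X j ω = T
    have h1 : (a i * X i ω + T) ^ 4 ≤ 8 * ((a i * X i ω) ^ 4 + T ^ 4) := by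
      have h2 : (a i * X i ω + T) ^ 2 ≤ 2 * ((a i * X i ω) ^ 2 + T ^ 2) := by
        nlinarith [sq_nonneg (a i * X i ω - T)]
      calc (a i * X i ω + T) ^ 4 = ((a i * X i ω + T) ^ 2) ^ 2 := by ring
        _ ≤ (2 * ((a i * X i ω) ^ 2 + T ^ 2)) ^ 2 := pow_le_pow_left₀ (sq_nonneg _) h2 2
        _ ≤ _ := by nlinarith [sq_nonneg ((a i * X i ω) ^ 2 - T ^ 2)]
    calc _ = X i ω ^ 4 * (a i * X i ω + T) ^ 4 := by rw [mul_pow]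
      _ ≤ X i ω ^ 4 * (8 * ((a i * X i ω) ^ 4 + T ^ 4)) :=
        mul_le_mul_of_nonneg_left h1 (by positivity)
      _ = _ := by ring
  have hint : Integrable (fun ω => (X i ω * ∑ j ∈ I, a j * X j ω) ^ 4) μ := by
    refine (h8.add (i1.const_mul 8)).mono' (((h.aestronglyMeasurable i).mul hSm.1).pow 4) ?_
    refine Eventually.of_forall fun ω => ?_
    exact (Real.norm_of_nonneg (by positivity)).trans_le (hdom ω)
  refine ⟨hint, (integral_mono hint (h8.add (i1.const_mul 8)) hdom).trans ?_⟩
  have hadd := integral_add h8 (i1.const_mul 8)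
  refine (le_of_eq hadd).trans ?_
  rw [integral_const_mul, integral_const_mul, e1, h.eighth, h.fourth]
  have h4 := integral_pow_four_sum_mul_le h.indep h.memLp_four h.mean h.second h.fourth
    (h.sq_second_le i) (I.erase i) a
  have hm4 : 0 ≤ m₄ := (sq_nonneg v).trans (h.sq_second_le i)
  have h5 : (∑ j ∈ I.erase i, a j ^ 2) ^ 2 ≤ (∑ j ∈ I, a j ^ 2) ^ 2 :=
    pow_le_pow_left₀ (Finset.sum_nonneg fun j _ => sq_nonneg _)
      (Finset.sum_le_sum_of_subset_of_nonneg (Finset.erase_subset _ _)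
        fun j _ _ => sq_nonneg _) 2
  have h6 := mul_le_mul_of_nonneg_left h4 hm4
  have h7 := mul_le_mul_of_nonneg_left h5 (by positivity : 0 ≤ m₄ * (3 * m₄))
  linarith

end IsErrorSequence

/-- The standardized mean `V⁻¹ (N⁻¹ ∑ X i • x i)`, where `y i = V⁻¹ x i`. -/
noncomputable def standardizedMean (I : Finset κ) (N : ℝ) (y : κ → ι → ℝ) (X : κ → Ω → ℝ) (ω : Ω) :
    ι → ℝ := N⁻¹ • ∑ j ∈ I, X j ω • y j

section Bounds

variable {X : κ → Ω → ℝ} {v w m₄ m₆ m₈ : ℝ} {I : Finset κ} {N C₀ C₁ D : ℝ} {x y : κ → ι → ℝ}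

omit [MeasurableSpace Ω] in
lemma dotProduct_standardizedMean (I : Finset κ) (N : ℝ) (y : κ → ι → ℝ) (X : κ → Ω → ℝ) (ω : Ω)
    (b : ι → ℝ) :
    b ⬝ᵥ standardizedMean I N y X ω = ∑ j ∈ I, (N⁻¹ * (b ⬝ᵥ y j)) * X j ω := by
  rw [standardizedMean, dotProduct_smul, dotProduct_sum, smul_eq_mul, Finset.mul_sum]
  refine Finset.sum_congr rfl fun j _ => ?_
  rw [dotProduct_smul, smul_eq_mul]
  ring

/-- Each coordinate is a linear form in the errors, so the expectation equals
$vN^{-1}\sum_j|y_j|^2$. For `D` of order $p$ this is the natural size $p$ of the quadratic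
statistic. -/
lemma integral_standardizedMean_sq_le (hX : IsErrorSequence X μ v w m₄ m₆ m₈)
    (h : IsRegularDesign I N v C₀ C₁ D x y) :
    Integrable (fun ω => N * (standardizedMean I N y X ω ⬝ᵥ standardizedMean I N y X ω)) μ ∧
    ∫ ω, N * (standardizedMean I N y X ω ⬝ᵥ standardizedMean I N y X ω) ∂μ
      ≤ v * D / C₀ ^ 2 := by
  have e : ∀ ω, standardizedMean I N y X ω ⬝ᵥ standardizedMean I N y X ω
      = ∑ s, (∑ j ∈ I, (N⁻¹ * y j s) * X j ω) ^ 2 := by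
    intro ω
    rw [dotProduct]
    refine Finset.sum_congr rfl fun s _ => ?_
    rw [← sq]
    congr 1
    simp only [standardizedMean, Pi.smul_apply, Finset.sum_apply, smul_eq_mul, Finset.mul_sum]
    exact Finset.sum_congr rfl fun j _ => by ring
  have hint : ∀ s ∈ (Finset.univ : Finset ι),
      Integrable (fun ω => (∑ j ∈ I, (N⁻¹ * y j s) * X j ω) ^ 2) μ := fun s _ =>
    (memLp_sum_mul hX.memLp_two I _).integrable_sq
  simp only [e]
  refine ⟨(integrable_finsetSum _ hint).const_mul N, ?_⟩
  rw [integral_const_mul, integral_finsetSum _ hint]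
  simp only [integral_sq_sum_mul hX.indep hX.memLp_two hX.mean hX.second]
  have hN := h.N_pos
  have hv := h.v_pos
  have h1 : ∑ s, v * ∑ j ∈ I, (N⁻¹ * y j s) ^ 2 = v * (N⁻¹ ^ 2 * ∑ j ∈ I, y j ⬝ᵥ y j) := by
    rw [← Finset.mul_sum, Finset.sum_comm]
    congr 1
    rw [Finset.mul_sum]
    refine Finset.sum_congr rfl fun j _ => ?_
    simp only [dotProduct, Finset.mul_sum]
    exact Finset.sum_congr rfl fun s _ => by ring
  have h2 : ∑ j ∈ I, y j ⬝ᵥ y j ≤ N * (D / C₀ ^ 2) := by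
    rw [← h.card, ← nsmul_eq_mul]
    exact Finset.sum_le_card_nsmul _ _ _ fun j hj => (h.solve_sq_le hj).1
  rw [h1]
  calc N * (v * (N⁻¹ ^ 2 * ∑ j ∈ I, y j ⬝ᵥ y j))
      ≤ N * (v * (N⁻¹ ^ 2 * (N * (D / C₀ ^ 2)))) := by gcongr
    _ = _ := by field_simp

/-- The term in `N ^ 3` comes from the error `X i` meeting itself inside the mean; the other comes
from the remaining, independent errors and owes its order $D^2/N$ to `gram_sq_sum_le`. -/
lemma integral_sum_pow_four_le (hX : IsErrorSequence X μ v w m₄ m₆ m₈)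
    (h : IsRegularDesign I N v C₀ C₁ D x y) :
    Integrable (fun ω => ∑ i ∈ I, ((X i ω • x i) ⬝ᵥ standardizedMean I N y X ω) ^ 4) μ ∧
    ∫ ω, ∑ i ∈ I, ((X i ω • x i) ⬝ᵥ standardizedMean I N y X ω) ^ 4 ∂μ
      ≤ 8 * m₈ * (D / C₀) ^ 4 / N ^ 3 + 24 * m₄ ^ 2 * (D / (v * C₀)) ^ 2 / N := by
  have e : ∀ i ω, ((X i ω • x i) ⬝ᵥ standardizedMean I N y X ω) ^ 4
      = (X i ω * ∑ j ∈ I, (N⁻¹ * (x i ⬝ᵥ y j)) * X j ω) ^ 4 := by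
    intro i ω
    rw [smul_dotProduct, dotProduct_standardizedMean, smul_eq_mul]
  simp only [e]
  have key := fun i (hi : i ∈ I) => hX.integral_pow_four_mul_le hi fun j => N⁻¹ * (x i ⬝ᵥ y j)
  refine ⟨integrable_finsetSum _ fun i hi => (key i hi).1, ?_⟩
  rw [integral_finsetSum _ fun i hi => (key i hi).1]
  have hN := h.N_pos
  have hv := h.v_pos
  have hC := h.C₀_pos
  have hD := h.D_nonneg
  have hle : ∀ i ∈ I, ∫ ω, (X i ω * ∑ j ∈ I, (N⁻¹ * (x i ⬝ᵥ y j)) * X j ω) ^ 4 ∂μ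
      ≤ 8 * m₈ * (N⁻¹ * (D / C₀)) ^ 4
        + 24 * m₄ ^ 2 * (N⁻¹ ^ 2 * (N * D / (v * C₀))) ^ 2 := by
    intro i hi
    refine (key i hi).2.trans ?_
    have hm8 : 0 ≤ m₈ := by
      rw [← hX.eighth i]
      exact integral_nonneg fun ω => by positivity
    obtain ⟨-, g0, g1⟩ := h.solve_sq_le hi
    have g2 := h.gram_sq_sum_le hi
    simp only [mul_pow _ _ 2, ← Finset.mul_sum]
    have : 0 ≤ ∑ j ∈ I, (x i ⬝ᵥ y j) ^ 2 := Finset.sum_nonneg fun j _ => sq_nonneg _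
    gcongr
  refine (Finset.sum_le_card_nsmul _ _ _ hle).trans (le_of_eq ?_)
  rw [nsmul_eq_mul, h.card]
  field_simp

omit [MeasurableSpace Ω] [Fintype ι] in
lemma meanOuter_sub_apply (I : Finset κ) (N v : ℝ) (x : κ → ι → ℝ) (X : κ → Ω → ℝ) (ω : Ω)
    (r s : ι) :
    (meanOuter I N (fun i => X i ω • x i) - v • meanOuter I N x) r s
      = ∑ i ∈ I, (N⁻¹ * (x i r * x i s)) * (X i ω ^ 2 - v) := by
  simp only [meanOuter, Matrix.sub_apply, Matrix.smul_apply, Matrix.sum_apply,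
    Matrix.vecMulVec_apply, Pi.smul_apply, smul_eq_mul, Finset.mul_sum, ← Finset.sum_sub_distrib]
  exact Finset.sum_congr rfl fun i _ => by ring

/-- Every entry is a linear form in the centered squares $X_i^2-v$, and summing the squared
coefficients over both indices produces $|x_i|^4$. -/
lemma integral_frobenius_le (hX : IsErrorSequence X μ v w m₄ m₆ m₈)
    (h : IsRegularDesign I N v C₀ C₁ D x y) :
    Integrable (fun ω => ∑ r, ∑ s,
      (meanOuter I N (fun i => X i ω • x i) - v • meanOuter I N x) r s ^ 2) μ ∧
    ∫ ω, ∑ r, ∑ s, (meanOuter I N (fun i => X i ω • x i) - v • meanOuter I N x) r s ^ 2 ∂μ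
      ≤ w * D ^ 2 / N := by
  simp only [meanOuter_sub_apply]
  have hind : iIndepFun (fun i ω => X i ω ^ 2 - v) μ :=
    hX.indep.comp (fun _ t => t ^ 2 - v) fun _ => by fun_prop
  have hint : ∀ r s, Integrable
      (fun ω => (∑ i ∈ I, (N⁻¹ * (x i r * x i s)) * (X i ω ^ 2 - v)) ^ 2) μ := fun r s =>
    (memLp_sum_mul hX.memLp_centered_sq I _).integrable_sq
  refine ⟨integrable_finsetSum _ fun r _ => integrable_finsetSum _ fun s _ => hint r s, ?_⟩
  rw [integral_finsetSum _ fun r _ => integrable_finsetSum _ fun s _ => hint r s]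
  simp_rw [integral_finsetSum _ fun s _ => hint _ s]
  simp only [integral_sq_sum_mul hind hX.memLp_centered_sq hX.integral_centered hX.centered_sq]
  have hN := h.N_pos
  have h1 : ∑ r, ∑ s, w * ∑ i ∈ I, (N⁻¹ * (x i r * x i s)) ^ 2
      = w * (N⁻¹ ^ 2 * ∑ i ∈ I, (x i ⬝ᵥ x i) ^ 2) := by
    simp only [← Finset.mul_sum]
    congr 1
    simp only [Finset.sum_comm (t := I), Finset.mul_sum]
    refine Finset.sum_congr rfl fun i _ => ?_
    rw [sq (x i ⬝ᵥ x i)]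
    simp only [dotProduct]
    rw [Finset.sum_mul_sum]
    simp only [Finset.mul_sum]
    exact Finset.sum_congr rfl fun r _ => Finset.sum_congr rfl fun s _ => by ring
  have h2 : ∑ i ∈ I, (x i ⬝ᵥ x i) ^ 2 ≤ N * D ^ 2 := by
    rw [← h.card, ← nsmul_eq_mul]
    exact Finset.sum_le_card_nsmul _ _ _ fun j hj =>
      pow_le_pow_left₀ (dotProduct_self_nonneg' _) (h.norm_le j hj) 2
  rw [h1]
  have hw : 0 ≤ w := by
    obtain ⟨i, -⟩ := Finset.card_pos.mp
      (Nat.cast_pos.mp (by rw [h.card]; exact hN : 0 < (I.card : ℝ)))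
    rw [← hX.centered_sq i]
    exact integral_nonneg fun ω => sq_nonneg _
  calc w * (N⁻¹ ^ 2 * ∑ i ∈ I, (x i ⬝ᵥ x i) ^ 2) ≤ w * (N⁻¹ ^ 2 * (N * D ^ 2)) := by gcongr
    _ = _ := by field_simp

/-- Inserting the standardized mean, $\rho=N^{-2}\sum_{i,j}(X_i^2-v)X_j\,(x_i^ty_j)\,x_i$. The
diagonal part need not be centered (third moments appear) and is handled by `sum_smul_sq_le`. The
off-diagonal part is, coordinate by coordinate, a degenerate bilinear form whose squared
coefficients are summed by `gram_sq_sum_le`. -/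
lemma integral_residual_sq_le (hX : IsErrorSequence X μ v w m₄ m₆ m₈)
    (h : IsRegularDesign I N v C₀ C₁ D x y) {ρ : Ω → ι → ℝ}
    (hρ : ∀ ω, ρ ω = meanOuter I N (fun i => X i ω • x i) *ᵥ standardizedMean I N y X ω
      - (v • meanOuter I N x) *ᵥ standardizedMean I N y X ω) :
    Integrable (fun ω => N * (ρ ω ⬝ᵥ ρ ω)) μ ∧
    ∫ ω, N * (ρ ω ⬝ᵥ ρ ω) ∂μ ≤ (2 * C₁ * m₆ / (v * C₀ ^ 2) + 4 * w / C₀) * D ^ 2 / N := by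
  classical
  have hN := h.N_pos
  have hv := h.v_pos
  have hC := h.C₀_pos
  have hC1 := h.C₁_pos
  have hD := h.D_nonneg
  set b : ι → κ → κ → ℝ := fun s i j => if i = j then 0 else (x i ⬝ᵥ y j) * x i s with hb
  set W : ι → Ω → ℝ := fun s ω => ∑ i ∈ I, ∑ j ∈ I, b s i j * ((X i ω ^ 2 - v) * X j ω) with hW
  set ξ : κ → Ω → ℝ := fun i ω => (x i ⬝ᵥ y i) * ((X i ω ^ 2 - v) * X i ω) with hξ
  have hρs : ∀ ω, ρ ω = N⁻¹ ^ 2 • (∑ i ∈ I, ξ i ω • x i + fun s => W s ω) := by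
    intro ω
    ext s
    rw [hρ, Matrix.smul_mulVec, meanOuter_mulVec, meanOuter_mulVec]
    simp only [smul_dotProduct, dotProduct_standardizedMean, Pi.sub_apply, Pi.smul_apply,
      Finset.sum_apply, smul_eq_mul, Pi.add_apply, hW, hξ, ← Finset.sum_add_distrib,
      Finset.mul_sum, ← Finset.sum_sub_distrib]
    refine Finset.sum_congr rfl fun i hi => ?_
    have h1 : ∀ j, b s i j * ((X i ω ^ 2 - v) * X j ω)
        = (x i ⬝ᵥ y j) * x i s * ((X i ω ^ 2 - v) * X j ω)
          - if i = j then (x i ⬝ᵥ y i) * x i s * ((X i ω ^ 2 - v) * X i ω) else 0 := by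
      intro j
      by_cases hij : i = j
      · subst hij; simp [hb]
      · simp [hb, hij]
    simp only [h1, Finset.sum_sub_distrib, Finset.sum_ite_eq, hi, if_true]
    rw [show ∀ a c : ℝ, a * x i s + (c - x i ⬝ᵥ y i * x i s * ((X i ω ^ 2 - v) * X i ω))
        = c + (a * x i s - x i ⬝ᵥ y i * x i s * ((X i ω ^ 2 - v) * X i ω)) from
        fun a c => by ring]
    rw [show x i ⬝ᵥ y i * ((X i ω ^ 2 - v) * X i ω) * x i s
      - x i ⬝ᵥ y i * x i s * ((X i ω ^ 2 - v) * X i ω) = 0 by ring, add_zero]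
    simp only [Finset.mul_sum, Finset.sum_mul, ← Finset.sum_sub_distrib]
    exact Finset.sum_congr rfl fun j _ => by ring
  have hbil := fun s => integral_sq_bilinear_le hX.indep hX.memLp_two hX.mean hX.second
    (φ := fun t => t ^ 2 - v) (by fun_prop) hX.memLp_centered_sq hX.integral_centered
    hX.centered_sq (b := b s) (fun i => by simp [hb]) I
  have hWint : ∀ s, Integrable (fun ω => W s ω ^ 2) μ := fun s => (hbil s).1.integrable_sq
  have hξint : ∀ i, Integrable (fun ω => ξ i ω ^ 2) μ := fun i => by
    simpa only [hξ, mul_pow (x i ⬝ᵥ y i)] using (hX.integrable_sixth i).const_mul _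
  have hdomint : Integrable (fun ω => N * (N⁻¹ ^ 4 * (2 * (N * C₁ / v * ∑ i ∈ I, ξ i ω ^ 2)
      + 2 * ∑ s, W s ω ^ 2))) μ :=
    (((((integrable_finsetSum _ fun i _ => hξint i).const_mul _).const_mul _).add
      ((integrable_finsetSum _ fun s _ => hWint s).const_mul _)).const_mul _).const_mul _
  have hdom : ∀ ω, N * (ρ ω ⬝ᵥ ρ ω) ≤ N * (N⁻¹ ^ 4 * (2 * (N * C₁ / v * ∑ i ∈ I, ξ i ω ^ 2)
      + 2 * ∑ s, W s ω ^ 2)) := by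
    intro ω
    refine mul_le_mul_of_nonneg_left ?_ hN.le
    rw [hρs, smul_dotProduct, dotProduct_smul, smul_eq_mul, smul_eq_mul, ← mul_assoc, ← pow_add]
    refine mul_le_mul_of_nonneg_left ?_ (by positivity)
    have h1 := h.sum_smul_sq_le fun i => ξ i ω
    have h2 : ∀ f g : ι → ℝ, (f + g) ⬝ᵥ (f + g) ≤ 2 * (f ⬝ᵥ f) + 2 * ∑ s, g s ^ 2 := by
      intro f g
      simp only [dotProduct, Finset.mul_sum, ← Finset.sum_add_distrib, Pi.add_apply]
      refine Finset.sum_le_sum fun s _ => ?_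
      nlinarith [sq_nonneg (f s - g s)]
    exact (h2 _ _).trans (by linarith)
  have hmeas : AEStronglyMeasurable (fun ω => N * (ρ ω ⬝ᵥ ρ ω)) μ := by
    have hρm : ∀ s, AEStronglyMeasurable (fun ω => ρ ω s) μ := by
      intro s
      have e : (fun ω => ρ ω s) = fun ω => N⁻¹ ^ 2 * (∑ i ∈ I, ξ i ω * x i s + W s ω) := by
        ext ω
        rw [hρs]
        simp [Finset.sum_apply]
      rw [e]
      refine AEStronglyMeasurable.const_mul (AEStronglyMeasurable.add ?_ (hbil s).1.1) _
      refine Finset.aestronglyMeasurable_fun_sum _ fun i _ => AEStronglyMeasurable.mul_const ?_ _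
      exact ((((hX.aestronglyMeasurable i).pow 2).sub aestronglyMeasurable_const).mul
        (hX.aestronglyMeasurable i)).const_mul _
    exact (Finset.aestronglyMeasurable_fun_sum _ fun s _ => (hρm s).mul (hρm s)).const_mul _
  have hint : Integrable (fun ω => N * (ρ ω ⬝ᵥ ρ ω)) μ := by
    refine hdomint.mono' hmeas (Eventually.of_forall fun ω => ?_)
    rw [Real.norm_of_nonneg (mul_nonneg hN.le (dotProduct_self_nonneg' _))]
    exact hdom ω
  refine ⟨hint, (integral_mono hint hdomint hdom).trans ?_⟩
  rw [integral_const_mul, integral_const_mul, integral_add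
    (((integrable_finsetSum _ fun i _ => hξint i).const_mul _).const_mul _)
    ((integrable_finsetSum _ fun s _ => hWint s).const_mul _), integral_const_mul,
    integral_const_mul, integral_const_mul, integral_finsetSum _ fun i _ => hξint i,
    integral_finsetSum _ fun s _ => hWint s]
  obtain ⟨i₀, -⟩ := Finset.card_pos.mp
    (Nat.cast_pos.mp (by rw [h.card]; exact hN : 0 < (I.card : ℝ)))
  have hw : 0 ≤ w := by
    rw [← hX.centered_sq i₀]
    exact integral_nonneg fun ω => sq_nonneg _
  have hm6 : 0 ≤ m₆ := by
    rw [← hX.sixth i₀]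
    exact integral_nonneg fun ω => sq_nonneg _
  have hξle : ∑ i ∈ I, ∫ ω, ξ i ω ^ 2 ∂μ ≤ N * ((D / C₀) ^ 2 * m₆) := by
    rw [← h.card, ← nsmul_eq_mul]
    refine Finset.sum_le_card_nsmul _ _ _ fun i hi => ?_
    simp only [hξ, mul_pow (x i ⬝ᵥ y i)]
    rw [integral_const_mul, hX.sixth]
    obtain ⟨-, g0, g1⟩ := h.solve_sq_le hi
    gcongr
  have hWle : ∑ s, ∫ ω, W s ω ^ 2 ∂μ ≤ 2 * w * v * (N * (D * (N * D / (v * C₀)))) := by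
    refine (Finset.sum_le_sum fun s _ => (hbil s).2).trans ?_
    rw [← Finset.mul_sum]
    refine mul_le_mul_of_nonneg_left ?_ (by positivity)
    rw [Finset.sum_comm, ← h.card, ← nsmul_eq_mul, h.card]
    refine Finset.sum_le_card_nsmul _ _ _ fun i hi => ?_
    have g2 := h.gram_sq_sum_le hi
    have g3 := h.norm_le i hi
    have g4 : 0 ≤ ∑ j ∈ I, (x i ⬝ᵥ y j) ^ 2 := Finset.sum_nonneg fun j _ => sq_nonneg _
    calc ∑ s, ∑ j ∈ I, b s i j ^ 2 ≤ ∑ s, ∑ j ∈ I, (x i s * x i s) * (x i ⬝ᵥ y j) ^ 2 := by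
          refine Finset.sum_le_sum fun s _ => Finset.sum_le_sum fun j _ => ?_
          by_cases hij : i = j
          · simp only [hb, hij, if_true]
            have h1 := mul_self_nonneg (x j s)
            have h2 := sq_nonneg (x j ⬝ᵥ y j)
            nlinarith
          · simp only [hb, hij, if_false]
            exact le_of_eq (by ring)
      _ = (x i ⬝ᵥ x i) * ∑ j ∈ I, (x i ⬝ᵥ y j) ^ 2 := by
          simp only [dotProduct, Finset.sum_mul_sum]
      _ ≤ _ := by gcongr
  calc N * (N⁻¹ ^ 4 * (2 * (N * C₁ / v * ∑ i ∈ I, ∫ ω, ξ i ω ^ 2 ∂μ)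
        + 2 * ∑ s, ∫ ω, W s ω ^ 2 ∂μ))
      ≤ N * (N⁻¹ ^ 4 * (2 * (N * C₁ / v * (N * ((D / C₀) ^ 2 * m₆)))
        + 2 * (2 * w * v * (N * (D * (N * D / (v * C₀))))))) := by gcongr
    _ = _ := by
      field_simp
      ring

end Bounds

end Errors

/-! ### Tail bounds -/

section Tail

lemma meas_lt_le_ofReal_div {Ω : Type*} [MeasurableSpace Ω] {μ : Measure Ω} {f : Ω → ℝ}
    (hf : Integrable f μ) (h0 : ∀ ω, 0 ≤ f ω) {M t : ℝ} (hM : ∫ ω, f ω ∂μ ≤ M) (ht : 0 < t) :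
    μ {ω | t < f ω} ≤ ENNReal.ofReal (M / t) := by
  have h1 := meas_ge_le_lintegral_div (μ := μ) (f := fun ω => ENNReal.ofReal (f ω))
    hf.1.aemeasurable.ennreal_ofReal (ENNReal.ofReal_pos.mpr ht).ne' ENNReal.ofReal_ne_top
  rw [← ofReal_integral_eq_lintegral_ofReal hf (Eventually.of_forall h0),
    ← ENNReal.ofReal_div_of_pos ht] at h1
  refine (measure_mono fun ω hω => ?_).trans (h1.trans (ENNReal.ofReal_le_ofReal (by gcongr)))
  exact ENNReal.ofReal_le_ofReal (le_of_lt hω)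

variable {Ω κ ι : Type*} [MeasurableSpace Ω] {μ : Measure Ω} [IsProbabilityMeasure μ] [Fintype ι]
  {X : κ → Ω → ℝ} {v w m₄ m₆ m₈ : ℝ} {I : Finset κ} {N C₀ C₁ D : ℝ} {x y : κ → ι → ℝ}

omit [MeasurableSpace Ω] in
lemma IsRegularDesign.mulVec_standardizedMean (h : IsRegularDesign I N v C₀ C₁ D x y) (ω : Ω) :
    (v • meanOuter I N x) *ᵥ standardizedMean I N y X ω = N⁻¹ • ∑ i ∈ I, X i ω • x i := by
  rw [standardizedMean, Matrix.mulVec_smul, Matrix.mulVec_sum]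
  simp only [Matrix.mulVec_smul, h.solve]

/-- Probability bound for the failure of the quadratic expansion of the empirical likelihood. -/
theorem measure_not_expansion_le (hX : IsErrorSequence X μ v w m₄ m₆ m₈) {B e P : ℝ}
    (h : IsRegularDesign I N v C₀ C₁ (B * P) x y) (hP : 1 ≤ P) (hB : 0 < B)
    (he : 0 < e) (hesmall : e + (2 / C₀ + 1) * e ^ 2 ≤ 1 / 2) (hPN : P ^ 2 ≤ N * e ^ 8) :
    μ {ω | ¬ ((∃ l, IsELMultiplier I (fun i => X i ω • x i) l) ∧
        ∀ l, IsELMultiplier I (fun i => X i ω • x i) l →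
          |2 * ∑ i ∈ I, Real.log (1 + l ⬝ᵥ (X i ω • x i))
            - N * (standardizedMean I N y X ω ⬝ᵥ
              ((v • meanOuter I N x) *ᵥ standardizedMean I N y X ω))|
          ≤ (17 + 16 * C₁ + 34 / C₀) * (√P * e))}
      ≤ ENNReal.ofReal (((2 * C₁ * m₆ / (v * C₀ ^ 2) + 4 * w / C₀) * B ^ 2
        + (8 * m₈ * (B / C₀) ^ 4 + 24 * m₄ ^ 2 * (B / (v * C₀)) ^ 2)
        + v * B / C₀ ^ 2 + 4 * w * B ^ 2 / C₀ ^ 2) * e ^ 2) := by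
  have hN := h.N_pos
  have hv := h.v_pos
  have hC := h.C₀_pos
  have hC1 := h.C₁_pos
  have hP0 : 0 < P := by linarith
  have he1 : e ≤ 1 := by
    have : 0 < (2 / C₀ + 1) * e ^ 2 := by positivity
    linarith
  set l₀ := fun ω => standardizedMean I N y X ω with hl₀
  set S := fun ω => meanOuter I N (fun i => X i ω • x i) with hS
  set V := v • meanOuter I N x with hV
  set ρ := fun ω => S ω *ᵥ l₀ ω - V *ᵥ l₀ ω with hρ
  obtain ⟨iA, eA⟩ := integral_residual_sq_le hX h (ρ := ρ) fun _ => rfl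
  obtain ⟨iF, eF⟩ := integral_sum_pow_four_le hX h
  obtain ⟨iQ, eQ⟩ := integral_standardizedMean_sq_le hX h
  obtain ⟨iR, eR⟩ := integral_frobenius_le hX h
  obtain ⟨i₀, -⟩ := Finset.card_pos.mp
    (Nat.cast_pos.mp (by rw [h.card]; exact hN : 0 < (I.card : ℝ)))
  have hw : 0 ≤ w := by
    rw [← hX.centered_sq i₀]
    exact integral_nonneg fun ω => sq_nonneg _
  have hm6 : 0 ≤ m₆ := by
    rw [← hX.sixth i₀]
    exact integral_nonneg fun ω => sq_nonneg _
  have hm8 : 0 ≤ m₈ := by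
    rw [← hX.eighth i₀]
    exact integral_nonneg fun ω => by positivity
  have hPN' : P ^ 2 / N ≤ e ^ 8 := by
    rw [div_le_iff₀ hN]
    linarith
  have he84 : e ^ 8 / e ^ 4 ≤ e ^ 2 := by
    rw [div_le_iff₀ (by positivity), ← pow_add]
    exact pow_le_pow_of_le_one he.le he1 (by norm_num)
  -- The expectation is of order `e ^ 8` and the threshold is `e ^ 4`, so the probability is of
  -- order `e ^ 4`, hence of order `e ^ 2`; the same accounting applies to the fourth-power sum.
  have pA : μ {ω | e ^ 4 < N * (ρ ω ⬝ᵥ ρ ω)} ≤ ENNReal.ofReal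
      (((2 * C₁ * m₆ / (v * C₀ ^ 2) + 4 * w / C₀) * B ^ 2) * e ^ 2) := by
    refine (meas_lt_le_ofReal_div iA (fun ω => mul_nonneg hN.le (dotProduct_self_nonneg' _))
      (M := ((2 * C₁ * m₆ / (v * C₀ ^ 2) + 4 * w / C₀) * B ^ 2) * e ^ 8) ?_
      (by positivity)).trans (ENNReal.ofReal_le_ofReal ?_)
    · refine eA.trans ?_
      rw [mul_pow, ← mul_assoc, mul_div_assoc]
      gcongr
    · rw [mul_div_assoc]
      gcongr
  have pF : μ {ω | e ^ 4 < ∑ i ∈ I, ((X i ω • x i) ⬝ᵥ l₀ ω) ^ 4} ≤ ENNReal.ofReal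
      ((8 * m₈ * (B / C₀) ^ 4 + 24 * m₄ ^ 2 * (B / (v * C₀)) ^ 2) * e ^ 2) := by
    refine (meas_lt_le_ofReal_div iF (fun ω => Finset.sum_nonneg fun i _ => by positivity)
      (M := (8 * m₈ * (B / C₀) ^ 4 + 24 * m₄ ^ 2 * (B / (v * C₀)) ^ 2) * e ^ 8) ?_
      (by positivity)).trans (ENNReal.ofReal_le_ofReal ?_)
    · refine eF.trans ?_
      have hN1 : 1 ≤ N := by
        have h5 := hN
        rw [← h.card] at h5 ⊢
        exact_mod_cast h5
      have h4 : P ^ 4 / N ^ 3 ≤ e ^ 8 := by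
        calc P ^ 4 / N ^ 3 = (P ^ 2 / N) * (P ^ 2 / N) * (1 / N) := by
              field_simp
          _ ≤ e ^ 8 * 1 * 1 := by
              have h5 : e ^ 8 ≤ 1 := pow_le_one₀ he.le he1
              have h6 : 1 / N ≤ 1 := by rw [div_le_one hN]; exact hN1
              gcongr
              exact hPN'.trans h5
          _ = e ^ 8 := by ring
      calc _ = 8 * m₈ * (B / C₀) ^ 4 * (P ^ 4 / N ^ 3)
            + 24 * m₄ ^ 2 * (B / (v * C₀)) ^ 2 * (P ^ 2 / N) := by ring
        _ ≤ 8 * m₈ * (B / C₀) ^ 4 * e ^ 8 + 24 * m₄ ^ 2 * (B / (v * C₀)) ^ 2 * e ^ 8 := by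
            gcongr
        _ = _ := by ring
    · rw [mul_div_assoc]
      gcongr
  -- Here the expectation is only of order `P`, so the threshold must exceed it by a diverging
  -- factor; this is where the final order `e ^ 2` is attained.
  have pQ : μ {ω | P / e ^ 2 < N * (l₀ ω ⬝ᵥ l₀ ω)} ≤ ENNReal.ofReal
      (v * B / C₀ ^ 2 * e ^ 2) := by
    refine (meas_lt_le_ofReal_div iQ (fun ω => mul_nonneg hN.le (dotProduct_self_nonneg' _))
      eQ (by positivity)).trans (ENNReal.ofReal_le_ofReal (le_of_eq ?_))
    field_simp
  have pR : μ {ω | (C₀ / 2) ^ 2 < ∑ r, ∑ s, (S ω - V) r s ^ 2} ≤ ENNReal.ofReal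
      (4 * w * B ^ 2 / C₀ ^ 2 * e ^ 2) := by
    refine (meas_lt_le_ofReal_div iR (fun ω => Finset.sum_nonneg fun r _ =>
      Finset.sum_nonneg fun s _ => sq_nonneg _) (M := w * B ^ 2 * e ^ 2) ?_
      (by positivity)).trans (ENNReal.ofReal_le_ofReal (le_of_eq ?_))
    · refine eR.trans ?_
      rw [mul_pow, ← mul_assoc, mul_div_assoc]
      have h5 : P ^ 2 / N ≤ e ^ 2 := hPN'.trans (pow_le_pow_of_le_one he.le he1 (by norm_num))
      gcongr
    · field_simp
      ring
  have hsub : {ω | ¬ ((∃ l, IsELMultiplier I (fun i => X i ω • x i) l) ∧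
        ∀ l, IsELMultiplier I (fun i => X i ω • x i) l →
          |2 * ∑ i ∈ I, Real.log (1 + l ⬝ᵥ (X i ω • x i)) - N * (l₀ ω ⬝ᵥ (V *ᵥ l₀ ω))|
          ≤ (17 + 16 * C₁ + 34 / C₀) * (√P * e))} ⊆
      (({ω | e ^ 4 < N * (ρ ω ⬝ᵥ ρ ω)} ∪ {ω | e ^ 4 < ∑ i ∈ I, ((X i ω • x i) ⬝ᵥ l₀ ω) ^ 4})
        ∪ {ω | P / e ^ 2 < N * (l₀ ω ⬝ᵥ l₀ ω)})
        ∪ {ω | (C₀ / 2) ^ 2 < ∑ r, ∑ s, (S ω - V) r s ^ 2} := by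
    intro ω hω
    by_contra hgood
    simp only [Set.mem_union, Set.mem_ofPred_eq, not_or, not_lt] at hgood
    obtain ⟨⟨⟨gA, gF⟩, gQ⟩, gR⟩ := hgood
    refine hω (exists_multiplier_and_abs_sub_le hN hC hC1 he hesmall hP
      (h.mulVec_standardizedMean ω) (h.upper _) (fun b => ?_) gA gF ?_)
    -- A Frobenius deviation of at most `C₀ / 2` costs at most half of the spectral lower bound of
    -- `V`.
    · have h1 := quadratic_form_sq_le (S ω - V) b
      have h2 := dotProduct_self_nonneg' b
      have h3 : (b ⬝ᵥ ((S ω - V) *ᵥ b)) ^ 2 ≤ (C₀ / 2 * (b ⬝ᵥ b)) ^ 2 := by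
        rw [mul_pow]
        exact h1.trans (mul_le_mul_of_nonneg_right gR (sq_nonneg _))
      have h4 := (abs_le.mp (abs_le_of_sq_le_sq h3 (by positivity))).1
      rw [Matrix.sub_mulVec, dotProduct_sub] at h4
      have h5 := h.lower b
      change _ ≤ b ⬝ᵥ (S ω *ᵥ b)
      linarith
    · rw [le_div_iff₀ (by positivity)] at gQ
      linarith
  refine (measure_mono hsub).trans ((measure_union_le _ _).trans ((add_le_add
    ((measure_union_le _ _).trans (add_le_add ((measure_union_le _ _).trans (add_le_add pA pF))
      pQ)) pR).trans (le_of_eq ?_)))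
  rw [← ENNReal.ofReal_add (by positivity) (by positivity),
    ← ENNReal.ofReal_add (by positivity) (by positivity),
    ← ENNReal.ofReal_add (by positivity) (by positivity)]
  congr 1
  ring

end Tail

/-! ### The two-phase model as a linear model with fixed design -/

section Spectrum

variable {ι : Type*} [Fintype ι]

lemma le_quadratic_form_of_spectrum [DecidableEq ι] {A : Matrix ι ι ℝ} (hA : A.IsHermitian) {c : ℝ}
    (hc : ∀ γ ∈ spectrum ℝ A, c ≤ γ) (b : ι → ℝ) : c * (b ⬝ᵥ b) ≤ b ⬝ᵥ (A *ᵥ b) := by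
  have hB : (A - algebraMap ℝ (Matrix ι ι ℝ) c).IsHermitian := by
    refine hA.sub ?_
    rw [Matrix.algebraMap_eq_diagonal]
    exact Matrix.isHermitian_diagonal _
  have hpos : (A - algebraMap ℝ (Matrix ι ι ℝ) c).PosSemidef := by
    rw [hB.posSemidef_iff_eigenvalues_nonneg]
    intro i
    have hmem := hB.eigenvalues_mem_spectrum_real i
    rw [← spectrum.sub_singleton_eq] at hmem
    obtain ⟨γ, hγ, r, hr, e⟩ := hmem
    rw [Set.mem_singleton_iff] at hr
    subst hr
    change 0 ≤ hB.eigenvalues i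
    rw [← e]
    exact sub_nonneg.mpr (hc γ hγ)
  have h := hpos.dotProduct_mulVec_nonneg b
  rw [star_trivial, Matrix.sub_mulVec, dotProduct_sub, Algebra.algebraMap_eq_smul_one,
    Matrix.smul_mulVec, Matrix.one_mulVec, dotProduct_smul, smul_eq_mul] at h
  linarith

lemma quadratic_form_le_of_spectrum [DecidableEq ι] {A : Matrix ι ι ℝ} (hA : A.IsHermitian) {c : ℝ}
    (hc : ∀ γ ∈ spectrum ℝ A, γ ≤ c) (b : ι → ℝ) : b ⬝ᵥ (A *ᵥ b) ≤ c * (b ⬝ᵥ b) := by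
  have h := le_quadratic_form_of_spectrum hA.neg (c := -c) (fun γ hγ => by
    rw [← spectrum.neg_eq, Set.mem_neg] at hγ
    have := hc _ hγ
    linarith) b
  rw [Matrix.neg_mulVec, dotProduct_neg] at h
  linarith

end Spectrum

lemma meanOuter_isHermitian {κ ι : Type*} (I : Finset κ) (N : ℝ) (u : κ → ι → ℝ) :
    (meanOuter I N u).IsHermitian := by
  ext r s
  simp only [meanOuter, Matrix.conjTranspose_apply, Matrix.smul_apply, Matrix.sum_apply,
    Matrix.vecMulVec_apply, star_trivial, mul_comm]

namespace TwoPhaseModel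

variable {Ω : Type*} (M : TwoPhaseModel Ω)

/-- The explanatory variables, divided by the relative size of the phase, with opposite signs in
the two phases. -/
noncomputable def scaledX (n i : ℕ) : Fin (M.p n) → ℝ :=
  (if i < M.k n then 1 / M.θ n else -(1 / (1 - M.θ n))) • M.X n i

variable {M}

lemma z_of_noChange (h : M.NoChange) (n i : ℕ) (ω : Ω) :
    M.z n i (M.β n) ω = M.ε i ω • M.X n i := by
  rw [z, Y, h n, ite_self, add_sub_cancel_left]

lemma k_le_of_θ_lt_one {n : ℕ} (h1 : M.θ n < 1) (h0 : 0 < M.θ n) : M.k n ≤ n := by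
  have hn : 0 < (n : ℝ) := by
    rcases Nat.eq_zero_or_pos n with h | h
    · subst h
      simp [θ] at h0
    · exact_mod_cast h
  rw [θ, div_lt_one hn] at h1
  exact_mod_cast h1.le

lemma dotProduct_scaledX_left {n i : ℕ} (hi : i ∈ Finset.range (M.k n)) (l : Fin (M.p n) → ℝ)
    (ω : Ω) : l ⬝ᵥ (M.ε i ω • M.scaledX n i) = (l ⬝ᵥ (M.ε i ω • M.X n i)) / M.θ n := by
  rw [scaledX, if_pos (Finset.mem_range.mp hi)]
  simp only [dotProduct_smul, smul_eq_mul]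
  ring

lemma dotProduct_scaledX_right {n i : ℕ} (hi : i ∈ Finset.Ico (M.k n) n) (l : Fin (M.p n) → ℝ)
    (ω : Ω) : l ⬝ᵥ (M.ε i ω • M.scaledX n i) = -((l ⬝ᵥ (M.ε i ω • M.X n i)) / (1 - M.θ n)) := by
  rw [scaledX, if_neg (Finset.mem_Ico.mp hi).1.not_gt]
  simp only [dotProduct_smul, smul_eq_mul]
  ring

lemma sum_range_eq {n : ℕ} (h0 : 0 < M.θ n) (h1 : M.θ n < 1) {E : Type*} [AddCommMonoid E]
    (f : ℕ → E) : ∑ i ∈ Finset.range n, f i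
      = ∑ i ∈ Finset.range (M.k n), f i + ∑ i ∈ Finset.Ico (M.k n) n, f i :=
  (Finset.sum_range_add_sum_Ico f (k_le_of_θ_lt_one h1 h0)).symm

/-- The rescaling turns $1+l^tu_i$ into the original denominator divided by the positive number
$\theta$ or $1-\theta$, so positivity transfers; in the equation the scale cancels and the sign
reproduces the difference of the two sums. -/
lemma isLagrangeMultiplier_iff (h : M.NoChange) {n : ℕ} (h0 : 0 < M.θ n) (h1 : M.θ n < 1) (ω : Ω)
    (l : Fin (M.p n) → ℝ) : M.IsLagrangeMultiplier n (M.β n) ω l ↔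
      IsELMultiplier (Finset.range n) (fun i => M.ε i ω • M.scaledX n i) l := by
  have hθ' : 0 < 1 - M.θ n := by linarith
  have eL : ∀ i ∈ Finset.range (M.k n), 1 + l ⬝ᵥ (M.ε i ω • M.scaledX n i)
      = (M.θ n + l ⬝ᵥ M.z n i (M.β n) ω) / M.θ n := by
    intro i hi
    rw [dotProduct_scaledX_left hi, z_of_noChange h]
    field_simp
  have eR : ∀ i ∈ Finset.Ico (M.k n) n, 1 + l ⬝ᵥ (M.ε i ω • M.scaledX n i)
      = (1 - M.θ n - l ⬝ᵥ M.z n i (M.β n) ω) / (1 - M.θ n) := by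
    intro i hi
    rw [dotProduct_scaledX_right hi, z_of_noChange h]
    field_simp
    ring
  have heq : ∑ i ∈ Finset.range n,
        (1 / (1 + l ⬝ᵥ (M.ε i ω • M.scaledX n i))) • (M.ε i ω • M.scaledX n i)
      = ∑ i ∈ Finset.range (M.k n), (1 / (M.θ n + l ⬝ᵥ M.z n i (M.β n) ω)) • M.z n i (M.β n) ω
        - ∑ j ∈ Finset.Ico (M.k n) n,
          (1 / (1 - M.θ n - l ⬝ᵥ M.z n j (M.β n) ω)) • M.z n j (M.β n) ω := by
    rw [sum_range_eq h0 h1, sub_eq_add_neg, ← Finset.sum_neg_distrib]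
    congr 1
    · refine Finset.sum_congr rfl fun i hi => ?_
      rw [eL i hi, z_of_noChange h, scaledX, if_pos (Finset.mem_range.mp hi), smul_smul, smul_smul,
        smul_smul]
      congr 1
      rw [one_div_div]
      field_simp
    · refine Finset.sum_congr rfl fun i hi => ?_
      rw [eR i hi, z_of_noChange h, scaledX, if_neg (Finset.mem_Ico.mp hi).1.not_gt, smul_smul,
        smul_smul, smul_smul, ← neg_smul]
      congr 1
      rw [one_div_div]
      field_simp
  constructor
  · intro hl
    refine ⟨fun i hi => ?_, heq.trans hl.equation⟩
    rcases lt_or_ge i (M.k n) with hik | hik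
    · have hi' := Finset.mem_range.mpr hik
      rw [eL i hi']
      exact div_pos (hl.pos_left i hi') h0
    · have hi' := Finset.mem_Ico.mpr ⟨hik, Finset.mem_range.mp hi⟩
      rw [eR i hi']
      exact div_pos (hl.pos_right i hi') hθ'
  · intro hl
    refine ⟨fun i hi => ?_, fun i hi => ?_, heq.symm.trans hl.equation⟩
    · have h2 := hl.pos i (Finset.mem_range.mpr
        ((Finset.mem_range.mp hi).trans_le (k_le_of_θ_lt_one h1 h0)))
      rw [eL i hi] at h2
      exact (div_pos_iff_of_pos_right h0).mp h2
    · have h2 := hl.pos i (Finset.mem_range.mpr (Finset.mem_Ico.mp hi).2)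
      rw [eR i hi] at h2
      exact (div_pos_iff_of_pos_right hθ').mp h2

lemma n_pos {n : ℕ} (h0 : 0 < M.θ n) : 0 < (n : ℝ) := by
  rcases Nat.eq_zero_or_pos n with h | h
  · subst h
    simp [θ] at h0
  · exact_mod_cast h

lemma EL_eq (h : M.NoChange) {n : ℕ} (h0 : 0 < M.θ n) (h1 : M.θ n < 1) (ω : Ω)
    (l : Fin (M.p n) → ℝ) : M.EL n (M.β n) ω l
      = 2 * ∑ i ∈ Finset.range n, Real.log (1 + l ⬝ᵥ (M.ε i ω • M.scaledX n i)) := by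
  have hn := n_pos h0
  have hk : (n : ℝ) / (M.k n : ℝ) = 1 / M.θ n := by rw [θ, one_div_div]
  have hk' : (n : ℝ) / ((n : ℝ) - (M.k n : ℝ)) = 1 / (1 - M.θ n) := by
    rw [θ, one_sub_div hn.ne', one_div_div]
  rw [EL, sum_range_eq h0 h1, mul_add, hk, hk']
  congr 2
  · refine Finset.sum_congr rfl fun i hi => ?_
    rw [dotProduct_scaledX_left hi, z_of_noChange h]
    congr 1
    ring
  · refine Finset.sum_congr rfl fun i hi => ?_
    rw [dotProduct_scaledX_right hi, z_of_noChange h]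
    congr 1
    ring

lemma ψ_eq (h : M.NoChange) {n : ℕ} (h0 : 0 < M.θ n) (h1 : M.θ n < 1) (ω : Ω) :
    M.ψ n (M.β n) ω = (n : ℝ)⁻¹ • ∑ i ∈ Finset.range n, M.ε i ω • M.scaledX n i := by
  rw [ψ, sum_range_eq h0 h1, smul_add, sub_eq_add_neg, ← smul_neg, ← Finset.sum_neg_distrib]
  simp only [Finset.smul_sum]
  congr 1
  · refine Finset.sum_congr rfl fun i hi => ?_
    rw [z_of_noChange h, scaledX, if_pos (Finset.mem_range.mp hi), smul_smul, smul_smul, smul_smul]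
    congr 1
    rw [one_div, mul_inv]
    ring
  · refine Finset.sum_congr rfl fun i hi => ?_
    rw [z_of_noChange h, scaledX, if_neg (Finset.mem_Ico.mp hi).1.not_gt, ← neg_smul, smul_smul,
      smul_smul, smul_smul]
    congr 1
    rw [one_div, mul_inv]
    ring

/-- From $t^2\le1+|t|^q$: the design condition makes the squared length of an explanatory vector of
order $p$. -/
lemma dotProduct_self_le_of_mean_rpow {p : ℕ} {x : Fin p → ℝ} {q C : ℝ} (hq : 2 ≤ q) (hp : 0 < p)
    (h : (p : ℝ)⁻¹ * ∑ s, |x s| ^ q < C) : x ⬝ᵥ x ≤ (1 + C) * p := by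
  have hp' : (0 : ℝ) < p := by exact_mod_cast hp
  have h1 : ∑ s, |x s| ^ q ≤ C * p := by
    rw [inv_mul_lt_iff₀ hp'] at h
    linarith
  have h2 : x ⬝ᵥ x ≤ ∑ s, (1 + |x s| ^ q) := by
    refine Finset.sum_le_sum fun s _ => ?_
    rw [← sq, ← sq_abs]
    rcases le_total |x s| 1 with hx | hx
    · have h3 : |x s| ^ 2 ≤ 1 := pow_le_one₀ (abs_nonneg _) hx
      have h4 : 0 ≤ |x s| ^ q := Real.rpow_nonneg (abs_nonneg _) q
      linarith
    · have h3 := Real.rpow_le_rpow_of_exponent_le hx hq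
      rw [Real.rpow_two] at h3
      linarith
  rw [Finset.sum_add_distrib] at h2
  simp only [Finset.sum_const, Finset.card_univ, Fintype.card_fin, nsmul_eq_mul, mul_one] at h2
  linarith

lemma scaledX_dotProduct_self_le {n i : ℕ} {a B : ℝ} (ha : 0 < a) (h0 : a ≤ M.θ n)
    (h1 : a ≤ 1 - M.θ n) (hB : M.X n i ⬝ᵥ M.X n i ≤ B) :
    M.scaledX n i ⬝ᵥ M.scaledX n i ≤ (1 / a) ^ 2 * B := by
  have hX := dotProduct_self_nonneg' (M.X n i)
  rw [scaledX, smul_dotProduct, dotProduct_smul, smul_eq_mul, smul_eq_mul, ← mul_assoc, ← sq]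
  refine mul_le_mul ?_ hB hX (by positivity)
  split_ifs
  · have : 0 < M.θ n := ha.trans_le h0
    gcongr
  · rw [neg_sq]
    have : 0 < 1 - M.θ n := ha.trans_le h1
    gcongr

variable [MeasurableSpace Ω] {μ : Measure Ω}

lemma Vi_eq {v : ℝ} {i : ℕ} (hε : AEMeasurable (M.ε i) μ) (h0 : ∫ ω, M.ε i ω ∂μ = 0)
    (hv : ∫ ω, M.ε i ω ^ 2 ∂μ = v) (n : ℕ) :
    M.Vi μ n i = v • Matrix.vecMulVec (M.X n i) (M.X n i) := by
  ext r s
  simp only [Vi, z₀, Matrix.of_apply, Pi.smul_apply, smul_eq_mul, Matrix.smul_apply,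
    Matrix.vecMulVec_apply]
  rw [covariance_mul_const_left, covariance_mul_const_right]
  rw [covariance_self hε, variance_of_integral_eq_zero hε h0, hv, mul_assoc, mul_comm (M.X n i s)]

lemma V_eq {v : ℝ} (hε : ∀ i, AEMeasurable (M.ε i) μ) (hmean : ∀ i, ∫ ω, M.ε i ω ∂μ = 0)
    (hv : ∀ i, ∫ ω, M.ε i ω ^ 2 ∂μ = v) {n : ℕ} (h0 : 0 < M.θ n) (h1 : M.θ n < 1) :
    M.V μ n = v • meanOuter (Finset.range n) n (M.scaledX n) := by
  rw [V, meanOuter, sum_range_eq h0 h1, smul_add, smul_add]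
  simp only [Finset.smul_sum]
  congr 1
  · refine Finset.sum_congr rfl fun i hi => ?_
    rw [Vi_eq (hε i) (hmean i) (hv i), scaledX, if_pos (Finset.mem_range.mp hi),
      Matrix.smul_vecMulVec, Matrix.vecMulVec_smul, smul_smul, smul_smul, smul_smul, smul_smul]
    congr 1
    rw [one_div, mul_inv]
    ring
  · refine Finset.sum_congr rfl fun i hi => ?_
    rw [Vi_eq (hε i) (hmean i) (hv i), scaledX, if_neg (Finset.mem_Ico.mp hi).1.not_gt,
      Matrix.smul_vecMulVec, Matrix.vecMulVec_smul, smul_smul, smul_smul, smul_smul, smul_smul]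
    congr 1
    generalize 1 - M.θ n = c
    rw [one_div, mul_inv]
    ring

lemma isErrorSequence_of_identDistrib [IsProbabilityMeasure μ] {ε : ℕ → Ω → ℝ} (h_indep : iIndepFun ε μ)
    (h_ident : ∀ i, IdentDistrib (ε i) (ε 0) μ μ) (h_mean : ∫ ω, ε 0 ω ∂μ = 0) {q : ℝ}
    (hq : 4 ≤ q) (h_moment : Integrable (fun ω => |ε 0 ω| ^ (2 * q)) μ) :
    IsErrorSequence ε μ (∫ ω, ε 0 ω ^ 2 ∂μ)
      (∫ ω, (ε 0 ω ^ 2 - ∫ ω, ε 0 ω ^ 2 ∂μ) ^ 2 ∂μ) (∫ ω, ε 0 ω ^ 4 ∂μ)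
      (∫ ω, ((ε 0 ω ^ 2 - ∫ ω, ε 0 ω ^ 2 ∂μ) * ε 0 ω) ^ 2 ∂μ) (∫ ω, ε 0 ω ^ 8 ∂μ) := by
  have hL : MemLp (ε 0) 8 μ := by
    have h1 : MemLp (ε 0) (ENNReal.ofReal (2 * q)) μ := by
      rw [← integrable_norm_rpow_iff (h_ident 0).aemeasurable_fst.aestronglyMeasurable
        (ENNReal.ofReal_pos.mpr (by linarith)).ne' ENNReal.ofReal_ne_top,
        ENNReal.toReal_ofReal (by linarith)]
      simpa only [Real.norm_eq_abs] using h_moment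
    refine h1.mono_exponent ?_
    rw [← ENNReal.ofReal_ofNat]
    exact ENNReal.ofReal_le_ofReal (by linarith)
  have hcomp : ∀ {φ : ℝ → ℝ}, Measurable φ → ∀ i, ∫ ω, φ (ε i ω) ∂μ = ∫ ω, φ (ε 0 ω) ∂μ :=
    fun hφ i => ((h_ident i).comp hφ).integral_eq
  exact
    { indep := h_indep
      memLp := fun i => (h_ident i).memLp_iff.mpr hL
      mean := fun i => (h_ident i).integral_eq.trans h_mean
      second := hcomp (φ := fun t => t ^ 2) (by fun_prop)
      fourth := hcomp (φ := fun t => t ^ 4) (by fun_prop)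
      sixth := hcomp (φ := fun t => ((t ^ 2 - ∫ ω, ε 0 ω ^ 2 ∂μ) * t) ^ 2) (by fun_prop)
      eighth := hcomp (φ := fun t => t ^ 8) (by fun_prop)
      centered_sq := hcomp (φ := fun t => (t ^ 2 - ∫ ω, ε 0 ω ^ 2 ∂μ) ^ 2) (by fun_prop) }

lemma isRegularDesign {v : ℝ} (hε : ∀ i, AEMeasurable (M.ε i) μ)
    (hmean : ∀ i, ∫ ω, M.ε i ω ∂μ = 0) (hv : ∀ i, ∫ ω, M.ε i ω ^ 2 ∂μ = v) {n : ℕ}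
    (h0 : 0 < M.θ n) (h1 : M.θ n < 1) (hp : 0 < M.p n) {C₀ C₁ D : ℝ} (hC₀ : 0 < C₀) (hC₁ : 0 < C₁)
    (heig : ∀ γ ∈ spectrum ℝ (M.V μ n), C₀ < γ ∧ γ < C₁)
    (hD : ∀ i ∈ Finset.range n, M.scaledX n i ⬝ᵥ M.scaledX n i ≤ D) :
    IsRegularDesign (Finset.range n) n v C₀ C₁ D (M.scaledX n)
      (fun i => (M.V μ n)⁻¹ *ᵥ M.scaledX n i) := by
  have hV := V_eq hε hmean hv h0 h1
  have hn := n_pos h0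
  have hVh : (M.V μ n).IsHermitian := by
    rw [hV]
    exact (meanOuter_isHermitian _ _ _).smul (by rw [isSelfAdjoint_iff, star_trivial])
  have hlow := le_quadratic_form_of_spectrum hVh fun γ hγ => (heig γ hγ).1.le
  have hup := quadratic_form_le_of_spectrum hVh fun γ hγ => (heig γ hγ).2.le
  have hpos : (M.V μ n).PosDef := by
    refine Matrix.PosDef.of_dotProduct_mulVec_pos hVh fun b hb => ?_
    rw [star_trivial]
    refine lt_of_lt_of_le (mul_pos hC₀ ?_) (hlow b)
    refine lt_of_le_of_ne (dotProduct_self_nonneg' b) fun h => hb ?_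
    exact dotProduct_self_eq_zero.mp h.symm
  have hdet := (Matrix.isUnit_iff_isUnit_det _).mp hpos.isUnit
  -- Nondegeneracy of the errors follows from the eigenvalue bound: with zero variance the positive
  -- definite matrix `V` would vanish, which is impossible in positive dimension.
  have hv0 : 0 < v := by
    have hvn : 0 ≤ v := by
      rw [← hv 0]
      exact integral_nonneg fun ω => sq_nonneg _
    refine lt_of_le_of_ne hvn fun h => ?_
    have h2 := hpos.diag_pos (i := ⟨0, hp⟩)
    rw [hV, ← h, zero_smul] at h2
    exact lt_irrefl _ h2
  refine ⟨by rw [Finset.card_range], hn, hv0, hC₀, hC₁, ?_, ?_, hD, fun i => ?_⟩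
  · rwa [← hV]
  · rwa [← hV]
  · rw [← hV, Matrix.mulVec_mulVec, Matrix.mul_nonsing_inv _ hdet, Matrix.one_mulVec]

end TwoPhaseModel

/-! ### The expansion under the hypothesis of no change -/

theorem proposition4 {Ω : Type*} [MeasurableSpace Ω] (μ : Measure Ω) [IsProbabilityMeasure μ]
    (M : TwoPhaseModel Ω)
    -- i.i.d. centered errors
    (h_indep : iIndepFun M.ε μ)
    (h_ident : ∀ i, IdentDistrib (M.ε i) (M.ε 0) μ μ)
    (h_mean : ∫ ω, M.ε 0 ω ∂μ = 0)
    -- growing dimension, location of the change-point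
    (h_p : Tendsto M.p atTop atTop)
    (θ₀ : ℝ) (h_θ₀ : θ₀ ∈ Set.Ioo (0 : ℝ) 1) (h_θ : Tendsto M.θ atTop (𝓝 θ₀))
    -- the eigenvalues of the mean matrices are bounded away from zero and infinity
    (h_eig : ∃ C₀ C₁ : ℝ, 0 < C₀ ∧ 0 < C₁ ∧
      ∀ᶠ n in atTop, ∀ γ ∈ spectrum ℝ (M.V μ n), C₀ < γ ∧ γ < C₁)
    (q : ℝ) (hq : 4 ≤ q)
    -- the design is bounded in mean of order `q`
    (h_design : ∃ C₃ : ℝ, 0 < C₃ ∧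
      ∀ n, ∀ i < n, (M.p n : ℝ)⁻¹ * ∑ s, |M.X n i s| ^ q < C₃)
    -- the errors have a finite absolute moment of order `2 q`
    (h_moment : Integrable (fun ω => |M.ε 0 ω| ^ (2 * q)) μ)
    -- growth of the dimension
    (h_growth_left : Tendsto
      (fun n => (M.p n : ℝ) ^ (2 + 4 / q) * ((M.k n : ℝ))⁻¹) atTop (𝓝 0))
    (h_growth_right : Tendsto
      (fun n => (M.p n : ℝ) ^ (2 + 4 / q) * ((n : ℝ) - (M.k n : ℝ))⁻¹) atTop (𝓝 0))
    -- growth of the fourth order moments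
    (h_fourth : (fun n => ∑ r, ∑ s, M.α μ n ![r, r, s, s]) =O[atTop]
      fun n => (M.p n : ℝ) ^ 2)
    -- the null hypothesis
    (h_null : M.NoChange)
    -- any choice of the Lagrange multipliers at the true parameter, where they exist
    (lam : (n : ℕ) → Ω → Fin (M.p n) → ℝ)
    (h_lam : ∀ n ω, (∃ l, M.IsLagrangeMultiplier n (M.β n) ω l) →
      M.IsLagrangeMultiplier n (M.β n) ω (lam n ω)) :
    -- they exist with probability tending to one, and the expansion holds
    Tendsto (fun n => μ {ω | ¬ M.IsLagrangeMultiplier n (M.β n) ω (lam n ω)}) atTop (𝓝 0) ∧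
    IsLittleOP μ
      (fun n ω => M.EL n (M.β n) ω (lam n ω)
        - n * (M.ψ n (M.β n) ω ⬝ᵥ ((M.V μ n)⁻¹ *ᵥ M.ψ n (M.β n) ω)))
      (fun n => Real.sqrt (M.p n)) := by
  classical
  obtain ⟨C₀, C₁, hC₀, hC₁, heig⟩ := h_eig
  obtain ⟨C₃, hC₃, hdes⟩ := h_design
  have hX := TwoPhaseModel.isErrorSequence_of_identDistrib h_indep h_ident h_mean hq h_moment
  set v := ∫ ω, M.ε 0 ω ^ 2 ∂μ
  set w := ∫ ω, (M.ε 0 ω ^ 2 - v) ^ 2 ∂μ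
  set m₄ := ∫ ω, M.ε 0 ω ^ 4 ∂μ
  set m₆ := ∫ ω, ((M.ε 0 ω ^ 2 - v) * M.ε 0 ω) ^ 2 ∂μ
  set m₈ := ∫ ω, M.ε 0 ω ^ 8 ∂μ
  have hε : ∀ i, AEMeasurable (M.ε i) μ := fun i => (hX.aestronglyMeasurable i).aemeasurable
  -- the relative sizes of the phases
  obtain ⟨a, ha, haθ, haθ'⟩ : ∃ a : ℝ, 0 < a ∧ a < θ₀ ∧ a < 1 - θ₀ :=
    ⟨min θ₀ (1 - θ₀) / 2, half_pos (lt_min h_θ₀.1 (sub_pos.mpr h_θ₀.2)),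
      (half_lt_self (lt_min h_θ₀.1 (sub_pos.mpr h_θ₀.2))).trans_le (min_le_left _ _),
      (half_lt_self (lt_min h_θ₀.1 (sub_pos.mpr h_θ₀.2))).trans_le (min_le_right _ _)⟩
  have hθ1 : ∀ᶠ n in atTop, a < M.θ n := h_θ.eventually_const_lt haθ
  have hθ2 : ∀ᶠ n in atTop, M.θ n < 1 - a := h_θ.eventually_lt_const (by linarith)
  have hp1 : ∀ᶠ n in atTop, 1 ≤ M.p n := h_p.eventually_ge_atTop 1
  -- the rate
  set t : ℕ → ℝ := fun n => (M.p n : ℝ) ^ 2 / n with ht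
  have ht0 : Tendsto t atTop (𝓝 0) := by
    refine squeeze_zero' (Eventually.of_forall fun n => by positivity) ?_ h_growth_left
    filter_upwards [hθ1, hθ2, hp1] with n h1 h2 h3
    have hθ0 := ha.trans h1
    have hkn : (M.k n : ℝ) ≤ n := by
      exact_mod_cast TwoPhaseModel.k_le_of_θ_lt_one (h2.trans (by linarith)) hθ0
    have hk : 0 < (M.k n : ℝ) := by
      have hn := TwoPhaseModel.n_pos hθ0
      have : (M.k n : ℝ) = M.θ n * n := by rw [TwoPhaseModel.θ, div_mul_cancel₀ _ hn.ne']
      rw [this]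
      positivity
    have h4 : (M.p n : ℝ) ^ 2 ≤ (M.p n : ℝ) ^ (2 + 4 / q) := by
      rw [← Real.rpow_two]
      refine Real.rpow_le_rpow_of_exponent_le (by exact_mod_cast h3) ?_
      have : 0 ≤ 4 / q := by positivity
      linarith
    rw [ht, ← div_eq_mul_inv]
    dsimp only
    gcongr
  -- The eighth root gives `e n ^ 8 = (M.p n) ^ 2 / n`, so the size condition of
  -- `measure_not_expansion_le` holds with equality.
  set e : ℕ → ℝ := fun n => t n ^ (1 / 8 : ℝ) with he
  have he0 : Tendsto e atTop (𝓝 0) := by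
    have := ht0.rpow_const (p := (1 / 8 : ℝ)) (Or.inr (by norm_num))
    rwa [Real.zero_rpow (by norm_num)] at this
  have hsmall : ∀ᶠ n in atTop, e n + (2 / C₀ + 1) * e n ^ 2 ≤ 1 / 2 := by
    have h1 : Tendsto (fun n => e n + (2 / C₀ + 1) * e n ^ 2) atTop (𝓝 0) := by
      simpa using he0.add ((he0.pow 2).const_mul (2 / C₀ + 1))
    exact h1.eventually_le_const (by norm_num)
  set B : ℝ := (1 / a) ^ 2 * (1 + C₃) with hB
  -- No measurability of `lam` is assumed, so this set need not be measurable; only monotonicity of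
  -- the outer measure is used.
  set bad : ℕ → Set Ω := fun n => {ω | ¬ (M.IsLagrangeMultiplier n (M.β n) ω (lam n ω) ∧
    |M.EL n (M.β n) ω (lam n ω)
        - n * (M.ψ n (M.β n) ω ⬝ᵥ ((M.V μ n)⁻¹ *ᵥ M.ψ n (M.β n) ω))|
      ≤ (17 + 16 * C₁ + 34 / C₀) * (√(M.p n) * e n))} with hbad
  have hbound : ∀ᶠ n in atTop, μ (bad n) ≤ ENNReal.ofReal
      (((2 * C₁ * m₆ / (v * C₀ ^ 2) + 4 * w / C₀) * B ^ 2
        + (8 * m₈ * (B / C₀) ^ 4 + 24 * m₄ ^ 2 * (B / (v * C₀)) ^ 2)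
        + v * B / C₀ ^ 2 + 4 * w * B ^ 2 / C₀ ^ 2) * e n ^ 2) := by
    filter_upwards [hθ1, hθ2, hp1, hsmall, heig] with n h1 h2 h3 h4 h5
    have hθ0 := ha.trans h1
    have hθ1' : M.θ n < 1 := h2.trans (by linarith)
    have hn := TwoPhaseModel.n_pos hθ0
    have hpn : (1 : ℝ) ≤ M.p n := by exact_mod_cast h3
    have ht' : 0 < t n := by positivity
    have hreg := TwoPhaseModel.isRegularDesign hε hX.mean hX.second hθ0 hθ1' h3 hC₀ hC₁ h5
      (D := B * M.p n) fun i hi => by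
        rw [hB, mul_assoc]
        exact TwoPhaseModel.scaledX_dotProduct_self_le ha h1.le (by linarith)
          (TwoPhaseModel.dotProduct_self_le_of_mean_rpow (by linarith) h3
            (hdes n i (Finset.mem_range.mp hi)))
    have he8 : e n ^ 8 = t n := by
      rw [he, ← Real.rpow_natCast, ← Real.rpow_mul ht'.le]
      norm_num
    refine (measure_mono fun ω hω => ?_).trans (measure_not_expansion_le hX hreg hpn
      (by positivity) (Real.rpow_pos_of_pos ht' _) h4 (le_of_eq ?_))
    · intro hgood
      refine hω ?_
      obtain ⟨⟨l, hl⟩, hall⟩ := hgood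
      have hlam := h_lam n ω
        ⟨l, (TwoPhaseModel.isLagrangeMultiplier_iff h_null hθ0 hθ1' ω l).mpr hl⟩
      refine ⟨hlam, ?_⟩
      have h6 := hall _ ((TwoPhaseModel.isLagrangeMultiplier_iff h_null hθ0 hθ1' ω _).mp hlam)
      rw [← TwoPhaseModel.EL_eq h_null hθ0 hθ1'] at h6
      -- Both sides are the same form because the standardized mean is $V^{-1}\psi$, so that
      -- applying $V$ to it returns $\psi$.
      have h7 : M.ψ n (M.β n) ω ⬝ᵥ ((M.V μ n)⁻¹ *ᵥ M.ψ n (M.β n) ω)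
          = standardizedMean (Finset.range n) n (fun i => (M.V μ n)⁻¹ *ᵥ M.scaledX n i) M.ε ω ⬝ᵥ
            ((v • meanOuter (Finset.range n) n (M.scaledX n)) *ᵥ
              standardizedMean (Finset.range n) n (fun i => (M.V μ n)⁻¹ *ᵥ M.scaledX n i)
                M.ε ω) := by
        rw [hreg.mulVec_standardizedMean, ← TwoPhaseModel.ψ_eq h_null hθ0 hθ1', dotProduct_comm]
        congr 1
        rw [TwoPhaseModel.ψ_eq h_null hθ0 hθ1', standardizedMean, Matrix.mulVec_smul,
          Matrix.mulVec_sum]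
        simp only [Matrix.mulVec_smul]
      rwa [← h7] at h6
    · rw [he8, ht, mul_div_cancel₀ _ hn.ne']
  have hbad0 : Tendsto (fun n => μ (bad n)) atTop (𝓝 0) := by
    refine tendsto_of_tendsto_of_tendsto_of_le_of_le' tendsto_const_nhds ?_
      (Eventually.of_forall fun _ => zero_le) hbound
    have h1 := ENNReal.tendsto_ofReal ((he0.pow 2).const_mul
      ((2 * C₁ * m₆ / (v * C₀ ^ 2) + 4 * w / C₀) * B ^ 2
        + (8 * m₈ * (B / C₀) ^ 4 + 24 * m₄ ^ 2 * (B / (v * C₀)) ^ 2)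
        + v * B / C₀ ^ 2 + 4 * w * B ^ 2 / C₀ ^ 2))
    simpa using h1
  refine ⟨tendsto_of_tendsto_of_tendsto_of_le_of_le tendsto_const_nhds hbad0
    (fun _ => zero_le) fun n => measure_mono fun ω hω hgood => hω hgood.1, fun δ hδ => ?_⟩
  have hδe : ∀ᶠ n in atTop, (17 + 16 * C₁ + 34 / C₀) * e n ≤ δ := by
    have h1 := he0.const_mul (17 + 16 * C₁ + 34 / C₀)
    rw [mul_zero] at h1
    exact h1.eventually_le_const hδ
  refine tendsto_of_tendsto_of_tendsto_of_le_of_le' tendsto_const_nhds hbad0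
    (Eventually.of_forall fun _ => zero_le) ?_
  filter_upwards [hδe] with n hn
  refine measure_mono fun ω hω hgood => ?_
  have h1 : δ * √(M.p n) < _ := hω
  have h2 : (17 + 16 * C₁ + 34 / C₀) * (√(M.p n) * e n) ≤ δ * √(M.p n) := by
    calc _ = ((17 + 16 * C₁ + 34 / C₀) * e n) * √(M.p n) := by ring
      _ ≤ _ := mul_le_mul_of_nonneg_right hn (Real.sqrt_nonneg _)
  exact absurd (hgood.2.trans h2) (not_le.mpr h1)
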